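/- **Bridge equation.** *Diagrams.* A rooted chord diagram of size $N$ is a fixed-point-free involution of $\{1,\dots,2N\}$; its transpositions $(x\,y)$, $x<y$, are its chords. Two chords $(x\,y),(x'\,y')$ cross if $x<x'<y<y'$ or $x'<x<y'<y$. The diagram is connected if $N\ge 1$ and the graph of crossings on its chords is connected. The root of a set of chords is the chord containing the smallest end point. The chords of a connected diagram $C$ are labelled $1,\dots,|C|$ in *intersection order*: first the root, then, recursively, the chords of each connected component of $C$ without its root, the components being taken in the order of their smallest end points. A chord is terminal if it crosses no chord with a larger first end point. If $t_0<t_1<\dots<t_m$ are the labels of the terminal chords, then $b(C):=t_0$, and the chord labelled $b(C)$ is the base chord. *Insertion tree.* For rooted plane binary trees $T,T'$, number the edges of $T'$ in pre-order, starting with a virtual edge $1$ above the root; $T\circ_k T'$ is obtained by putting a new vertex in the middle of edge $k$ of $T'$, whose left subtree is $T$ and whose right subtree is the part of $T'$ below edge $k$. The tree $T(C)$ of a connected diagram $C$, with leaves labelled by the chords, is a single leaf if $|C|=1$. Otherwise let $C_1$ be the first connected component of $C$ without its root, let $y$ be the second end point of the root of $C$, let $k$ be the number of end points of chords of $C_1$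 below $y$, and put $T(C)=T(C\setminus C_1)\circ_k T(C_1)$, where the leaves keep their labels from $C$. For the chord labelled $c$, $\nu_c=\nu_c(C)$ is the number of edges on the path in $T(C)$ that starts at the leaf $c$ and goes up and to the left (from a right child to its parent) as long as possible. *Weights.* Let $R$ be a commutative $\mathbb Q$-algebra, let $s\in R$ and $a_{k,i}\in R$ ($k\ge1$, $i\ge0$), and let $D$ be a set of positive integers with $1\in D$. Let $\mathcal R^{\mathrm{dec}}$ be the set of connected rooted chord diagrams $C$ each of whose chords $c$ carries a decoration $d_c\in D$. Put $\|C\|=\sum_{c} d_c$, $$\hat a_C=\prod_{c=1}^{m} a_{d_{t_c},\,t_c-t_{c-1}}\cdot\prod_{c\text{ not terminal}} a_{d_c,0},\qquad \omega_C=\prod_{c=1}^{|C|}\binom{d_c s+\nu_c-2}{\nu_c},\qquad \omega_{\hat C}=\prod_{c\neq b(C)}\binom{d_c s+\nu_c-2}{\nu_c},$$ with $\binom{x}{n}=x(x-1)\cdots(x-n+1)/n!$, and $$g_l^{\mathrm{comb}}(x)=\sum_{C\in\mathcal R^{\mathrm{dec}},\ b(C)\ge l} x^{\|C\|}\,\omega_C\,\hat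 a_C\,a_{d_{b(C)},\,b(C)-l}\in R[[x]].$$ *Statement.* For all integers $n\ge1$ and $i,j\ge0$, $$\sum_{\substack{C\in\mathcal R^{\mathrm{dec}},\ \|C\|=i+1,\ b(C)=j+1\\ d_{j+1}=1,\ \nu_{j+1}=n}}\hat a_C\,\omega_{\hat C}=[x^i]\left.\Big(\sum_{l\ge1}\frac{g_l^{\mathrm{comb}}(x)}{l!}\,\partial_\rho^{\,l}\Big)^{n}\rho^j\right|_{\rho=0},$$ where the operator acts $n$ times on $\rho^j\in R[[x]][\rho]$ and $\rho=0$ is substituted afterwards. -/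

import Mathlib

open scoped Nat
open scoped PowerSeries

noncomputable section

namespace ChordDSE

/-! ### Sets of chords

A chord is a pair `c = (x, y)` of points of a linear order, with end points `x = c.1 < y = c.2`.
Diagrams and all their sub-diagrams are handled as finite sets of chords; only the relative order
of the end points matters, so sub-diagrams need not be renumbered. -/

section ChordSets

variable {α : Type*} [LinearOrder α]

/-- Two chords cross when their end points interlace. -/
def Crosses (c d : α × α) : Prop :=
  (c.1 < d.1 ∧ d.1 < c.2 ∧ c.2 < d.2) ∨ (d.1 < c.1 ∧ c.1 < d.2 ∧ d.2 < c.2)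

/-- The intersection graph of a set of chords. -/
def intersectionGraph (S : Finset (α × α)) : SimpleGraph {c // c ∈ S} where
  Adj c d := Crosses c.1 d.1
  symm := ⟨fun _ _ h => Or.symm h⟩
  loopless := ⟨fun _ h => by
    rcases h with h | h <;> exact lt_irrefl _ h.1⟩

/-- The root chord of a nonempty set of chords: the chord with the smallest first end point. -/
def root (S : Finset (α × α)) (h : S.Nonempty) : α × α :=
  (S.exists_min_image Prod.fst h).choose

theorem root_mem (S : Finset (α × α)) (h : S.Nonempty) : root S h ∈ S :=
  (S.exists_min_image Prod.fst h).choose_spec.1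

/-- The chords of the connected component of `c` in the intersection graph of `S`. -/
def component (S : Finset (α × α)) (c : α × α) : Finset (α × α) := by
  classical
  exact S.filter fun d =>
    ∃ (hc : c ∈ S) (hd : d ∈ S), (intersectionGraph S).Reachable ⟨c, hc⟩ ⟨d, hd⟩

theorem component_subset (S : Finset (α × α)) (c : α × α) : component S c ⊆ S := by
  classical
  exact Finset.filter_subset _ _

theorem mem_component_self {S : Finset (α × α)} {c : α × α} (hc : c ∈ S) :
    c ∈ component S c := by
  classical
  exact Finset.mem_filter.2 ⟨hc, hc, hc, SimpleGraph.Reachable.refl _⟩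

/-- The chords of `S` listed in intersection order. For connected `S` this is the root, followed by
the intersection orders of the connected components of `S` without its root, the components being
taken in the order of their first end points. For general `S`, the connected components of `S` are
listed one after the other in the order of their first end points. -/
def intersectionOrder (S : Finset (α × α)) : List (α × α) :=
  if h : S.Nonempty then
    root S h :: (intersectionOrder ((component S (root S h)).erase (root S h)) ++
      intersectionOrder (S \ component S (root S h)))
  else []
termination_by S.card
decreasing_by
  · exact lt_of_lt_of_le
      (Finset.card_erase_lt_of_mem (mem_component_self (root_mem S h)))
      (Finset.card_le_card (component_subset S _))
  · exact Finset.card_lt_card (Finset.sdiff_ssubset (component_subset S _)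
      ⟨_, mem_component_self (root_mem S h)⟩)

end ChordSets

/-! ### Rooted plane binary trees with labelled leaves -/

/-- Rooted plane binary trees whose leaves are labelled by elements of `β`. -/
inductive LeafTree (β : Type*) where
  | leaf (b : β) : LeafTree β
  | node (l r : LeafTree β) : LeafTree β

namespace LeafTree

variable {β : Type*}

/-- The number of vertices, which is also the number of edges including the virtual edge above
the root. -/
def numVertices : LeafTree β → ℕ
  | leaf _ => 1
  | node l r => 1 + l.numVertices + r.numVertices

/-- `b` is the label of some leaf. -/
def HasLeaf (b : β) : LeafTree β → Prop
  | leaf b' => b' = b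
  | node l r => l.HasLeaf b ∨ r.HasLeaf b

/-- `insertAt T k T'` is the tree `T ∘ₖ T'`: the edges of `T'` are numbered from `1` in pre-order
(the virtual edge above the root is number `1`), a new vertex is put in the middle of edge `k`, its
left subtree is `T` and its right subtree is the part of `T'` below edge `k`. It is meaningful for
`1 ≤ k ≤ T'.numVertices`. -/
def insertAt (T : LeafTree β) : ℕ → LeafTree β → LeafTree β
  | k, leaf b => if k ≤ 1 then node T (leaf b) else leaf b
  | k, node l r =>
      if k ≤ 1 then node T (node l r)
      else if k ≤ 1 + l.numVertices then node (insertAt T (k - 1) l) r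
      else node l (insertAt T (k - 1 - l.numVertices) r)

open Classical in
/-- Auxiliary function for `branchLeft`: `m` is the length of the path that starts at the root of
the current subtree and moves up and to the left as long as possible in the ambient tree. -/
def branchLeftAux (b : β) : ℕ → LeafTree β → ℕ
  | m, leaf _ => m
  | m, node l r => if l.HasLeaf b then branchLeftAux b 0 l else branchLeftAux b (m + 1) r

/-- For a leaf labelled `b` (occurring once), the number of edges of the path that starts at this
leaf and moves up and to the left, i.e. from a right child to its parent, as long as possible. -/
def branchLeft (T : LeafTree β) (b : β) : ℕ := branchLeftAux b 0 T

end LeafTree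

section InsertionTree

variable {α : Type*} [LinearOrder α]

/-- The number of end points of chords of `S` that are smaller than `y`. -/
def numEndpointsBelow (S : Finset (α × α)) (y : α) : ℕ :=
  (S.filter fun c => c.1 < y).card + (S.filter fun c => c.2 < y).card

/-- The insertion tree of a (connected) nonempty set `S` of chords; its leaves are labelled by the
chords themselves. Let `r` be the root chord of `S`, and let `S₁` be the first connected component
of `S` without `r`. The root share decomposition is `S = (S \ S₁) ∘ₖ S₁`, where the end points of
`S \ S₁` other than the first end point of `r` lie in the `k`-th interval between the end points
of `S₁`, i.e. `k` is the number of end points of `S₁` below the second end point of `r`. -/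
def insertionTree (S : Finset (α × α)) (h : S.Nonempty) : LeafTree (α × α) :=
  if h' : (S.erase (root S h)).Nonempty then
    LeafTree.insertAt
      (insertionTree
        (S \ component (S.erase (root S h)) (root (S.erase (root S h)) h'))
        ⟨root S h, Finset.mem_sdiff.2 ⟨root_mem S h, fun hm =>
          Finset.notMem_erase _ _ (component_subset _ _ hm)⟩⟩)
      (numEndpointsBelow
        (component (S.erase (root S h)) (root (S.erase (root S h)) h')) (root S h).2)
      (insertionTree
        (component (S.erase (root S h)) (root (S.erase (root S h)) h'))
        ⟨_, mem_component_self (root_mem _ h')⟩)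
  else LeafTree.leaf (root S h)
termination_by S.card
decreasing_by
  · exact Finset.card_lt_card (Finset.sdiff_ssubset
      ((component_subset _ _).trans (Finset.erase_subset _ _))
      ⟨_, mem_component_self (root_mem _ h')⟩)
  · exact lt_of_le_of_lt (Finset.card_le_card (component_subset _ _))
      (Finset.card_erase_lt_of_mem (root_mem S h))

end InsertionTree

/-! ### Rooted chord diagrams -/

/-- A rooted chord diagram of size `n`: a fixed-point-free involution of `2n` points. -/
structure ChordDiagram (n : ℕ) where
  perm : Equiv.Perm (Fin (2 * n))
  involutive : ∀ i, perm (perm i) = i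
  fixedPointFree : ∀ i, perm i ≠ i

namespace ChordDiagram

variable {n : ℕ}

/-- The chords, i.e. the transpositions `(x y)` with `x < y`. -/
def chords (C : ChordDiagram n) : Finset (Fin (2 * n) × Fin (2 * n)) :=
  Finset.univ.filter fun c => c.1 < c.2 ∧ C.perm c.1 = c.2

/-- A chord diagram is connected if its intersection graph is connected (in particular it has at
least one chord). -/
def IsConnected (C : ChordDiagram n) : Prop := (intersectionGraph C.chords).Connected

theorem card_chords (C : ChordDiagram n) : C.chords.card = n := by
  classical
  have h1 : C.chords.card = (Finset.univ.filter fun i : Fin (2 * n) => i < C.perm i).card := by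
    refine Finset.card_bij (fun c _ => c.1) ?_ ?_ ?_
    · intro c hc
      simp only [chords, Finset.mem_filter, Finset.mem_univ, true_and] at hc ⊢
      rw [hc.2]; exact hc.1
    · intro c hc d hd h
      simp only [chords, Finset.mem_filter, Finset.mem_univ, true_and] at hc hd
      exact Prod.ext h (by rw [← hc.2, ← hd.2, h])
    · intro i hi
      simp only [Finset.mem_filter, Finset.mem_univ, true_and] at hi
      exact ⟨(i, C.perm i), by simp [chords, hi], rfl⟩
  have h2 : (Finset.univ.filter fun i : Fin (2 * n) => i < C.perm i).card =
      (Finset.univ.filter fun i : Fin (2 * n) => ¬ i < C.perm i).card := by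
    refine Finset.card_bij (fun i _ => C.perm i) ?_ ?_ ?_
    · intro i hi
      simp only [Finset.mem_filter, Finset.mem_univ, true_and] at hi ⊢
      rw [C.involutive]; exact hi.asymm
    · intro i _ j _ h
      exact C.perm.injective h
    · intro i hi
      simp only [Finset.mem_filter, Finset.mem_univ, true_and, not_lt] at hi
      refine ⟨C.perm i, ?_, C.involutive i⟩
      simp only [Finset.mem_filter, Finset.mem_univ, true_and, C.involutive]
      exact lt_of_le_of_ne hi (C.fixedPointFree i)
  have h3 := Finset.card_filter_add_card_filter_not (s := (Finset.univ : Finset (Fin (2 * n))))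
    (fun i => i < C.perm i)
  rw [Finset.card_univ, Fintype.card_fin] at h3
  omega

end ChordDiagram

instance (n : ℕ) : Finite (ChordDiagram n) :=
  Finite.of_injective ChordDiagram.perm fun C C' h => by
    cases C; cases C'; cases h; rfl

/-! ### Decorated diagrams -/

/-- Rooted connected chord diagrams whose chords carry decorations from the set `D` of positive
integers. -/
structure DecDiagram (D : Set ℕ+) where
  size : ℕ
  diagram : ChordDiagram size
  connected : diagram.IsConnected
  dec : {c // c ∈ diagram.chords} → ℕ+
  dec_mem : ∀ c, dec c ∈ D

namespace DecDiagram

variable {D : Set ℕ+}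

/-- The type of chords of a decorated diagram. -/
abbrev Chord (C : DecDiagram D) : Type := {c // c ∈ C.diagram.chords}

theorem chords_nonempty (C : DecDiagram D) : C.diagram.chords.Nonempty :=
  let ⟨c⟩ := C.connected.nonempty
  ⟨c.1, c.2⟩

/-- The label of a chord: its position, counted from `1`, in the intersection order. -/
def label (C : DecDiagram D) (c : C.Chord) : ℕ :=
  (intersectionOrder C.diagram.chords).idxOf c.1 + 1

/-- The weight `‖C‖`, the sum of all decorations. -/
def norm (C : DecDiagram D) : ℕ := ∑ c : C.Chord, (C.dec c : ℕ)

open Classical in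
/-- The terminal chords: those that cross no chord with a larger first end point. -/
def terminal (C : DecDiagram D) : Finset C.Chord :=
  Finset.univ.filter fun c => ∀ c' : C.Chord, c.1.1 < c'.1.1 → ¬ Crosses c.1 c'.1

theorem terminal_nonempty (C : DecDiagram D) : C.terminal.Nonempty := by
  classical
  obtain ⟨c, hc⟩ := C.chords_nonempty
  obtain ⟨d, -, hd⟩ := Finset.exists_max_image (Finset.univ : Finset C.Chord)
    (fun c => c.1.1) ⟨⟨c, hc⟩, Finset.mem_univ _⟩
  exact ⟨d, Finset.mem_filter.2 ⟨Finset.mem_univ _, fun c' h =>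
    absurd h (hd c' (Finset.mem_univ _)).not_gt⟩⟩

/-- The base chord: the terminal chord with the smallest label. -/
def baseChord (C : DecDiagram D) : C.Chord :=
  (C.terminal.exists_min_image C.label C.terminal_nonempty).choose

/-- `b(C)`, the label of the base chord. -/
def b (C : DecDiagram D) : ℕ := C.label C.baseChord

/-- The label of the terminal chord preceding the terminal chord `c` (for `c` not the base
chord). -/
def prevTerminal (C : DecDiagram D) (c : C.Chord) : ℕ :=
  (C.terminal.filter fun c' => C.label c' < C.label c).sup C.label

/-- The entry `ν_c` of the branch-left vector that belongs to the chord `c`. -/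
def nu (C : DecDiagram D) (c : C.Chord) : ℕ :=
  (insertionTree C.diagram.chords C.chords_nonempty).branchLeft c.1

theorem finite_norm_eq (D : Set ℕ+) (w : ℕ) : {C : DecDiagram D | C.norm = w}.Finite := by
  classical
  let X := Σ n : Fin (w + 1), Σ C : {C : ChordDiagram n // C.IsConnected},
    {f : {c // c ∈ C.1.chords} → Set.Icc (1 : ℕ+) (w.succPNat) // ∀ c, (f c : ℕ+) ∈ D}
  let F : X → DecDiagram D := fun x =>
    ⟨x.1, x.2.1.1, x.2.1.2, fun c => (x.2.2.1 c : ℕ+), x.2.2.2⟩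
  refine (Set.finite_range F).subset ?_
  rintro ⟨n, C, hC, f, hf⟩ h
  have h : ∑ c, (f c : ℕ) = w := h
  have hn : n < w + 1 := by
    have : ∑ c : {c // c ∈ C.chords}, 1 ≤ ∑ c, (f c : ℕ) :=
      Finset.sum_le_sum fun c _ => (f c).pos
    rw [h] at this
    simp only [Finset.sum_const, smul_eq_mul, mul_one, Finset.card_univ, Fintype.card_coe,
      C.card_chords] at this
    omega
  have hle : ∀ c, f c ∈ Set.Icc (1 : ℕ+) (w.succPNat) := fun c => by
    refine ⟨one_le, ?_⟩
    have : (f c : ℕ) ≤ ∑ c, (f c : ℕ) :=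
      Finset.single_le_sum (f := fun c => (f c : ℕ)) (fun _ _ => Nat.zero_le _)
        (Finset.mem_univ c)
    rw [← PNat.coe_le_coe, Nat.succPNat_coe]
    omega
  exact ⟨⟨⟨n, hn⟩, ⟨C, hC⟩, ⟨fun c => ⟨f c, hle c⟩, hf⟩⟩, rfl⟩

/-- The finite set of all decorated diagrams `C` with `‖C‖ = w`. -/
def ofNorm (D : Set ℕ+) (w : ℕ) : Finset (DecDiagram D) := (finite_norm_eq D w).toFinset

section Weights

variable {R : Type*} [CommRing R] [Algebra ℚ R]

/-- The generalized binomial coefficient `x (x - 1) ⋯ (x - n + 1) / n!`. -/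
def binom (x : R) (n : ℕ) : R := (n ! : ℚ)⁻¹ • ∏ m ∈ Finset.range n, (x - m)

/-- The factor of the weight that belongs to the chord `c`. -/
def chordWeight (s : R) (C : DecDiagram D) (c : C.Chord) : R :=
  binom (((C.dec c : ℕ) : R) * s + (C.nu c : R) - 2) (C.nu c)

/-- The weight `ω(C)`. -/
def weight (s : R) (C : DecDiagram D) : R := ∏ c : C.Chord, chordWeight s C c

/-- The weight `ω_Ĉ`: the factor of the base chord is left out. -/
def weightHat (s : R) (C : DecDiagram D) : R := by
  classical
  exact ∏ c ∈ Finset.univ.erase C.baseChord, chordWeight s C c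

/-- The monomial `â_C`. -/
def monomialHat (a : ℕ+ → ℕ → R) (C : DecDiagram D) : R := by
  classical
  exact (∏ c ∈ C.terminal.erase C.baseChord, a (C.dec c) (C.label c - C.prevTerminal c)) *
    ∏ c ∈ Finset.univ \ C.terminal, a (C.dec c) 0

/-- The power series `g_k^comb(x)`. -/
def gComb (D : Set ℕ+) (s : R) (a : ℕ+ → ℕ → R) (k : ℕ) : R⟦X⟧ :=
  PowerSeries.mk fun w => ∑ C ∈ (ofNorm D w).filter fun C => k ≤ C.b,
    weight s C * monomialHat a C * a (C.dec C.baseChord) (C.b - k)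

end Weights

end DecDiagram

/-- The differential operator `∑_{l ≥ 1} (g_l / l!) ∂_ρ^l` on polynomials in `ρ` over a power series
ring. Derivatives of order larger than the degree vanish, so the sum may be truncated there. -/
def diffOp {R : Type*} [CommRing R] [Algebra ℚ R] (g : ℕ → R⟦X⟧) (p : Polynomial R⟦X⟧) :
    Polynomial R⟦X⟧ :=
  ∑ l ∈ Finset.Icc 1 p.natDegree, ((l ! : ℚ)⁻¹ • g l) • Polynomial.derivative^[l] p

end ChordDSE

end

/-! A connected diagram with at least two chords is in a unique way `C' ∘ₖ C''`: `C''` is the first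
component left after removing the root, `C'` is the rest, and `k` is one of the `2|C''| - 1` gaps
between end points of `C''` (`DecDiagram.exists_eq_join`, `DecDiagram.join_injective`). All
ingredients of the weights respect this. The base chord is that of `C''`, with its label raised by
one (`b_join`), and `â_C = â_{C'} · a_{d, b(C')-1} · â_{C''}` with `d` the decoration of the base
chord of `C'` (`monomialHat_join`). In the insertion tree the branch-left numbers of `C'` are
unchanged, while exactly one of those of `C''` grows by one, that of the chord "hit" by the edge
`k`; a chord `c` is hit by `ν_c + 1` edges (`nu_inl`, `nu_inr`, `sum_hit`).

Write `ω(d, ν)` for the binomial factor. Since `(ν + 1) ω(d, ν + 1) = (d s + ν - 1) ω(d, ν)` and `∑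
(ν_c - 1) = -1`, summing over `k` multiplies the weight of `C''` by `s‖C''‖ - 1`. This is the
renormalization group equation `g_{l+1} = g_1 (s x ∂ₓ - 1) g_l` (`gComb_succ`). The same sum, with
the factor of the base chord left out and its branch-left number recorded as `n`, gives for the
series `B_{j,n}` of the left-hand sides the recursion `B_{j+1,n} = g_1 (n B_{j,n-1} + (s x ∂ₓ - n)
B_{j,n})` (`bridgeSeries_succ`).

For the right-hand side, the pairing with `⟨ρ^j, t^j⟩ = j!` makes `∂_ρ` adjoint to multiplication by
`t`, so that the right-hand side is `j! [t^j] G^n` with `G = ∑ g_l t^l / l!`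
(`eval_iterate_diffOp`). The renormalization group equation reads `∂ₜ G = g_1 (1 + (s x ∂ₓ - 1) G)`,
and as `s x ∂ₓ` is a derivation, `∂ₜ G^n = g_1 (n G^{n-1} + (s x ∂ₓ - n) G^n)`. Both families thus
obey one recursion in `j`, and at `j = 0` both are `1` for `n = 0` and `0` otherwise
(`bridgeSeries_eq`). -/

noncomputable section

namespace ChordDSE

/-! ### Connectedness through closed sets; unfolding the recursive definitions. -/

section Connectivity

variable {α : Type*} [LinearOrder α]

theorem Crosses.symm {c d : α × α} (h : Crosses c d) : Crosses d c := Or.symm h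

/-- `B` is a union of connected components of `S`. -/
def IsClosedIn (B S : Finset (α × α)) : Prop :=
  B ⊆ S ∧ ∀ x ∈ B, ∀ y ∈ S, Crosses x y → y ∈ B

/-- Connectedness of a set of chords, expressed through unions of components. -/
def Conn (S : Finset (α × α)) : Prop :=
  S.Nonempty ∧ ∀ B, IsClosedIn B S → B.Nonempty → B = S

theorem mem_component {S : Finset (α × α)} {c d : α × α} :
    d ∈ component S c ↔
      ∃ (hc : c ∈ S) (hd : d ∈ S), (intersectionGraph S).Reachable ⟨c, hc⟩ ⟨d, hd⟩ := by
  classical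
  rw [component, Finset.mem_filter]
  exact ⟨fun h => h.2, fun h => ⟨h.2.1, h⟩⟩

theorem isClosedIn_component (S : Finset (α × α)) (c : α × α) :
    IsClosedIn (component S c) S := by
  refine ⟨component_subset S c, fun x hx y hy hxy => ?_⟩
  obtain ⟨hc, hx', hr⟩ := mem_component.1 hx
  refine mem_component.2 ⟨hc, hy, hr.trans (SimpleGraph.Adj.reachable ?_)⟩
  exact hxy

theorem mem_of_reachable {S B : Finset (α × α)} (hB : IsClosedIn B S) {x y : {c // c ∈ S}}
    (h : (intersectionGraph S).Reachable x y) (hx : x.1 ∈ B) : y.1 ∈ B := by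
  obtain ⟨w⟩ := h
  induction w with
  | nil => exact hx
  | cons hadj _ ih => exact ih (hB.2 _ hx _ (Subtype.mem _) hadj)

theorem component_subset_of_isClosedIn {S B : Finset (α × α)} {c : α × α} (hB : IsClosedIn B S)
    (hc : c ∈ B) : component S c ⊆ B := by
  intro d hd
  obtain ⟨_, _, h⟩ := mem_component.1 hd
  exact mem_of_reachable hB h hc

/-- A closed part that misses `c` has a closed complement containing `c`; that complement is then
the whole component, so the part is empty. -/
theorem conn_component {S : Finset (α × α)} {c : α × α} (hc : c ∈ S) :
    Conn (component S c) := by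
  classical
  refine ⟨⟨c, mem_component_self hc⟩, fun B hB hne => ?_⟩
  have hcl := isClosedIn_component S c
  have hBS : IsClosedIn B S :=
    ⟨hB.1.trans hcl.1, fun x hx y hy h => hB.2 x hx y (hcl.2 x (hB.1 hx) y hy h) h⟩
  by_cases hcB : c ∈ B
  · exact hB.1.antisymm (component_subset_of_isClosedIn hBS hcB)
  · have hd : IsClosedIn (component S c \ B) S := by
      refine ⟨Finset.sdiff_subset.trans hcl.1, fun x hx y hy h => ?_⟩
      rw [Finset.mem_sdiff] at hx ⊢
      exact ⟨hcl.2 x hx.1 y hy h, fun hyB => hx.2 (hB.2 y hyB x hx.1 h.symm)⟩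
    have := component_subset_of_isClosedIn hd
      (Finset.mem_sdiff.2 ⟨mem_component_self hc, hcB⟩)
    obtain ⟨x, hx⟩ := hne
    exact absurd hx (Finset.mem_sdiff.1 (this (hB.1 hx))).2

/-- The criterion by which components are identified below, without handling walks in the graph. -/
theorem component_eq {S A : Finset (α × α)} {c : α × α} (hA : IsClosedIn A S) (hconn : Conn A)
    (hc : c ∈ A) : component S c = A := by
  have hsub := component_subset_of_isClosedIn hA hc
  refine hconn.2 _ ⟨hsub, fun x hx y hy h => ?_⟩ ⟨c, mem_component_self (hA.1 hc)⟩
  exact (isClosedIn_component S c).2 x hx y (hA.1 hy) h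

theorem isClosedIn_self (S : Finset (α × α)) : IsClosedIn S S :=
  ⟨subset_rfl, fun _ _ _ hy _ => hy⟩

theorem connected_iff_conn {S : Finset (α × α)} : (intersectionGraph S).Connected ↔ Conn S := by
  constructor
  · intro h
    obtain ⟨c⟩ := h.nonempty
    refine ⟨⟨c.1, c.2⟩, fun B hB ⟨x, hx⟩ => hB.1.antisymm fun y hy => ?_⟩
    exact mem_of_reachable hB (h.preconnected ⟨x, hB.1 hx⟩ ⟨y, hy⟩) hx
  · intro h
    obtain ⟨c, hc⟩ := h.1
    have : Nonempty {c // c ∈ S} := ⟨⟨c, hc⟩⟩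
    refine ⟨fun x y => ?_⟩
    have := component_eq (isClosedIn_self S) h x.2
    obtain ⟨_, _, hr⟩ := mem_component.1 (this.symm ▸ y.2 : y.1 ∈ component S x.1)
    exact hr

theorem Conn.component_eq {S : Finset (α × α)} (h : Conn S) {c : α × α} (hc : c ∈ S) :
    component S c = S := ChordDSE.component_eq (isClosedIn_self S) h hc

/-- The chords are non-degenerate and no two of them share an end point. -/
structure Proper (S : Finset (α × α)) : Prop where
  lt : ∀ c ∈ S, c.1 < c.2
  fst_inj : ∀ c ∈ S, ∀ d ∈ S, c.1 = d.1 → c = d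
  snd_inj : ∀ c ∈ S, ∀ d ∈ S, c.2 = d.2 → c = d
  fst_ne_snd : ∀ c ∈ S, ∀ d ∈ S, c.1 ≠ d.2

theorem Proper.mono {S T : Finset (α × α)} (h : Proper S) (hT : T ⊆ S) : Proper T :=
  ⟨fun c hc => h.lt c (hT hc), fun c hc d hd => h.fst_inj c (hT hc) d (hT hd),
    fun c hc d hd => h.snd_inj c (hT hc) d (hT hd),
    fun c hc d hd => h.fst_ne_snd c (hT hc) d (hT hd)⟩

theorem root_fst_le {S : Finset (α × α)} (h : S.Nonempty) {c : α × α} (hc : c ∈ S) :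
    (root S h).1 ≤ c.1 :=
  (S.exists_min_image Prod.fst h).choose_spec.2 c hc

theorem Proper.root_eq {S : Finset (α × α)} (hS : Proper S) (h : S.Nonempty) {r : α × α}
    (hr : r ∈ S) (hmin : ∀ c ∈ S, r.1 ≤ c.1) : root S h = r :=
  hS.fst_inj _ (root_mem S h) _ hr ((root_fst_le h hr).antisymm (hmin _ (root_mem S h)))

theorem intersectionOrder_empty : intersectionOrder (∅ : Finset (α × α)) = [] := by
  rw [intersectionOrder, dif_neg (by simp)]

theorem intersectionOrder_eq_component_append {S : Finset (α × α)} (h : S.Nonempty) :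
    intersectionOrder S = root S h ::
      (intersectionOrder ((component S (root S h)).erase (root S h)) ++
      intersectionOrder (S \ component S (root S h))) := by
  rw [intersectionOrder, dif_pos h]

theorem Conn.intersectionOrder_eq {S : Finset (α × α)} (h : Conn S) :
    intersectionOrder S = root S h.1 :: intersectionOrder (S.erase (root S h.1)) := by
  rw [intersectionOrder_eq_component_append h.1, h.component_eq (root_mem S h.1),
    Finset.sdiff_self, intersectionOrder_empty, List.append_nil]

theorem mem_intersectionOrder {S : Finset (α × α)} {c : α × α} :
    c ∈ intersectionOrder S ↔ c ∈ S := by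
  induction hn : S.card using Nat.strong_induction_on generalizing S with
  | _ n ih =>
    subst hn
    by_cases h : S.Nonempty
    · have hr := root_mem S h
      have hcr := mem_component_self hr
      have hsub := component_subset S (root S h)
      rw [intersectionOrder_eq_component_append h, List.mem_cons, List.mem_append,
        ih _ (lt_of_lt_of_le (Finset.card_erase_lt_of_mem hcr) (Finset.card_le_card hsub)) rfl,
        ih _ (Finset.card_lt_card (Finset.sdiff_ssubset hsub ⟨_, hcr⟩)) rfl,
        Finset.mem_erase, Finset.mem_sdiff]
      constructor
      · rintro (rfl | h | h)
        exacts [hr, hsub h.2, h.1]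
      · intro hc
        tauto
    · rw [Finset.not_nonempty_iff_eq_empty.1 h, intersectionOrder_empty]
      simp

theorem nodup_intersectionOrder (S : Finset (α × α)) : (intersectionOrder S).Nodup := by
  induction hn : S.card using Nat.strong_induction_on generalizing S with
  | _ n ih =>
    subst hn
    by_cases h : S.Nonempty
    · have hr := root_mem S h
      have hcr := mem_component_self hr
      have hsub := component_subset S (root S h)
      rw [intersectionOrder_eq_component_append h, List.nodup_cons, List.nodup_append]
      refine ⟨?_, ih _ (lt_of_lt_of_le (Finset.card_erase_lt_of_mem hcr)
        (Finset.card_le_card hsub)) _ rfl,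
        ih _ (Finset.card_lt_card (Finset.sdiff_ssubset hsub ⟨_, hcr⟩)) _ rfl, ?_⟩
      · simp [mem_intersectionOrder, hcr]
      · intro x hx y hy hxy
        subst hxy
        rw [mem_intersectionOrder] at hx hy
        exact (Finset.mem_sdiff.1 hy).2 (Finset.mem_of_mem_erase hx)
    · rw [Finset.not_nonempty_iff_eq_empty.1 h, intersectionOrder_empty]
      exact List.nodup_nil

theorem length_intersectionOrder (S : Finset (α × α)) : (intersectionOrder S).length = S.card := by
  classical
  rw [← List.toFinset_card_of_nodup (nodup_intersectionOrder S)]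
  congr 1
  ext c
  rw [List.mem_toFinset, mem_intersectionOrder]

theorem insertionTree_of_card_eq_one {S : Finset (α × α)} (h : S.Nonempty)
    (h' : ¬ (S.erase (root S h)).Nonempty) : insertionTree S h = LeafTree.leaf (root S h) := by
  rw [insertionTree, dif_neg h']

/-- The two parts enter as variables with equations because the trees depend on nonemptiness proofs,
which would obstruct rewriting. -/
theorem insertionTree_eq_insertAt {S A B : Finset (α × α)} (h : S.Nonempty)
    (h' : (S.erase (root S h)).Nonempty)
    (hA : component (S.erase (root S h)) (root (S.erase (root S h)) h') = A)
    (hB : S \ A = B) (hA0 : A.Nonempty) (hB0 : B.Nonempty) :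
    insertionTree S h = LeafTree.insertAt (insertionTree B hB0)
      (numEndpointsBelow A (root S h).2) (insertionTree A hA0) := by
  subst hB; subst hA
  rw [insertionTree, dif_pos h']

end Connectivity

/-! ### Invariance of all constructions under order embeddings. -/

section Relabelling

namespace LeafTree

variable {β γ : Type*}

/-- Relabel the leaves of a tree. -/
def map (f : β → γ) : LeafTree β → LeafTree γ
  | leaf b => leaf (f b)
  | node l r => node (l.map f) (r.map f)

theorem numVertices_map (f : β → γ) (T : LeafTree β) : (T.map f).numVertices = T.numVertices := by
  induction T with
  | leaf => rfl
  | node l r hl hr => simp only [map, numVertices, hl, hr]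

theorem insertAt_map (f : β → γ) (T : LeafTree β) (k : ℕ) (T' : LeafTree β) :
    insertAt (T.map f) k (T'.map f) = (insertAt T k T').map f := by
  induction T' generalizing k with
  | leaf b => simp only [map, insertAt]; split_ifs <;> rfl
  | node l r hl hr =>
    simp only [map, insertAt, numVertices_map, hl, hr]
    split_ifs <;> rfl

theorem hasLeaf_map {f : β → γ} (hf : Function.Injective f) (T : LeafTree β) (b : β) :
    (T.map f).HasLeaf (f b) ↔ T.HasLeaf b := by
  induction T with
  | leaf b' => exact hf.eq_iff
  | node l r hl hr => simp only [map, HasLeaf, hl, hr]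

theorem branchLeftAux_map {f : β → γ} (hf : Function.Injective f) (T : LeafTree β) (b : β)
    (m : ℕ) : branchLeftAux (f b) m (T.map f) = branchLeftAux b m T := by
  induction T generalizing m with
  | leaf b' => rfl
  | node l r hl hr =>
    simp only [map, branchLeftAux, hl, hr]
    by_cases h : l.HasLeaf b
    · rw [if_pos h, if_pos ((hasLeaf_map hf l b).2 h)]
    · rw [if_neg h, if_neg (mt (hasLeaf_map hf l b).1 h)]

theorem branchLeft_map {f : β → γ} (hf : Function.Injective f) (T : LeafTree β) (b : β) :
    (T.map f).branchLeft (f b) = T.branchLeft b :=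
  branchLeftAux_map hf T b 0

end LeafTree

variable {α β : Type*} [LinearOrder α] [LinearOrder β]

/-- The action of an order embedding on chords. -/
def chordEmb (f : α ↪o β) : α × α ↪ β × β := f.toEmbedding.prodMap f.toEmbedding

@[simp]
theorem chordEmb_fst (f : α ↪o β) (c : α × α) : (chordEmb f c).1 = f c.1 := rfl

@[simp]
theorem chordEmb_snd (f : α ↪o β) (c : α × α) : (chordEmb f c).2 = f c.2 := rfl

theorem crosses_chordEmb (f : α ↪o β) {c d : α × α} :
    Crosses (chordEmb f c) (chordEmb f d) ↔ Crosses c d := by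
  simp [Crosses]

theorem IsClosedIn.map (f : α ↪o β) {B S : Finset (α × α)} (h : IsClosedIn B S) :
    IsClosedIn (B.map (chordEmb f)) (S.map (chordEmb f)) := by
  refine ⟨Finset.map_subset_map.2 h.1, ?_⟩
  simp only [Finset.mem_map]
  rintro _ ⟨x, hx, rfl⟩ _ ⟨y, hy, rfl⟩ hxy
  exact ⟨y, h.2 x hx y hy ((crosses_chordEmb f).1 hxy), rfl⟩

theorem conn_map_iff (f : α ↪o β) {S : Finset (α × α)} :
    Conn (S.map (chordEmb f)) ↔ Conn S := by
  classical
  constructor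
  · rintro ⟨hne, h⟩
    refine ⟨Finset.map_nonempty.1 hne, fun B hB hB0 => ?_⟩
    exact Finset.map_injective _ (h _ (hB.map f) (Finset.map_nonempty.2 hB0))
  · rintro ⟨hne, h⟩
    refine ⟨Finset.map_nonempty.2 hne, fun B hB hB0 => ?_⟩
    obtain ⟨B', hB', rfl⟩ := Finset.subset_map_iff.1 hB.1
    congr 1
    refine h B' ⟨hB', fun x hx y hy hxy => ?_⟩ (Finset.map_nonempty.1 hB0)
    have := hB.2 _ (Finset.mem_map_of_mem _ hx) _ (Finset.mem_map_of_mem _ hy)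
      ((crosses_chordEmb f).2 hxy)
    exact (Finset.mem_map' _).1 this

theorem Proper.map (f : α ↪o β) {S : Finset (α × α)} (h : Proper S) :
    Proper (S.map (chordEmb f)) := by
  constructor
  · simp only [Finset.mem_map]
    rintro _ ⟨c, hc, rfl⟩
    exact f.lt_iff_lt.2 (h.lt c hc)
  · simp only [Finset.mem_map]
    rintro _ ⟨c, hc, rfl⟩ _ ⟨d, hd, rfl⟩ e
    rw [h.fst_inj c hc d hd (f.injective e)]
  · simp only [Finset.mem_map]
    rintro _ ⟨c, hc, rfl⟩ _ ⟨d, hd, rfl⟩ e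
    rw [h.snd_inj c hc d hd (f.injective e)]
  · simp only [Finset.mem_map]
    rintro _ ⟨c, hc, rfl⟩ _ ⟨d, hd, rfl⟩ e
    exact h.fst_ne_snd c hc d hd (f.injective e)

/-- `root` is a chosen minimiser, so it commutes with relabelling only because `Proper` makes the
minimiser unique. -/
theorem root_map (f : α ↪o β) {S : Finset (α × α)} (hS : Proper S) (h : S.Nonempty)
    (h' : (S.map (chordEmb f)).Nonempty) :
    root (S.map (chordEmb f)) h' = chordEmb f (root S h) := by
  refine (hS.map f).root_eq h' (Finset.mem_map_of_mem _ (root_mem S h)) ?_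
  simp only [Finset.mem_map]
  rintro _ ⟨c, hc, rfl⟩
  exact f.le_iff_le.2 (root_fst_le h hc)

theorem component_map (f : α ↪o β) {S : Finset (α × α)} {c : α × α} (hc : c ∈ S) :
    component (S.map (chordEmb f)) (chordEmb f c) = (component S c).map (chordEmb f) :=
  component_eq ((isClosedIn_component S c).map f) ((conn_map_iff f).2 (conn_component hc))
    (Finset.mem_map_of_mem _ (mem_component_self hc))

theorem intersectionOrder_map (f : α ↪o β) {S : Finset (α × α)} (hS : Proper S) :
    intersectionOrder (S.map (chordEmb f)) = (intersectionOrder S).map (chordEmb f) := by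
  induction hn : S.card using Nat.strong_induction_on generalizing S with
  | _ n ih =>
    subst hn
    by_cases h : S.Nonempty
    · have h' : (S.map (chordEmb f)).Nonempty := Finset.map_nonempty.2 h
      have hr := root_mem S h
      have hcr := mem_component_self hr
      have hsub := component_subset S (root S h)
      rw [intersectionOrder_eq_component_append h, intersectionOrder_eq_component_append h',
        root_map f hS h, component_map f hr, ← Finset.map_erase, ← Finset.map_sdiff,
        ih _ (lt_of_lt_of_le (Finset.card_erase_lt_of_mem hcr) (Finset.card_le_card hsub))
          (hS.mono ((Finset.erase_subset _ _).trans hsub)) rfl,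
        ih _ (Finset.card_lt_card (Finset.sdiff_ssubset hsub ⟨_, hcr⟩))
          (hS.mono Finset.sdiff_subset) rfl]
      simp
    · rw [Finset.not_nonempty_iff_eq_empty.1 h]
      simp [intersectionOrder_empty]

theorem numEndpointsBelow_map (f : α ↪o β) (S : Finset (α × α)) (y : α) :
    numEndpointsBelow (S.map (chordEmb f)) (f y) = numEndpointsBelow S y := by
  simp [numEndpointsBelow, Finset.filter_map, Function.comp_def]

theorem insertionTree_map (f : α ↪o β) {S : Finset (α × α)} (hS : Proper S) (h : S.Nonempty)
    (h' : (S.map (chordEmb f)).Nonempty) :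
    insertionTree (S.map (chordEmb f)) h' = (insertionTree S h).map (chordEmb f) := by
  induction hn : S.card using Nat.strong_induction_on generalizing S with
  | _ n ih =>
    subst hn
    have hr := root_mem S h
    have hroot := root_map f hS h h'
    have herase : (S.map (chordEmb f)).erase (root (S.map (chordEmb f)) h') =
        (S.erase (root S h)).map (chordEmb f) := by
      rw [hroot, Finset.map_erase]
    by_cases he : (S.erase (root S h)).Nonempty
    · have he' : ((S.map (chordEmb f)).erase (root (S.map (chordEmb f)) h')).Nonempty := by
        rw [herase]; exact Finset.map_nonempty.2 he
      have hSe := hS.mono (Finset.erase_subset (root S h) S)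
      have hr2 := root_mem _ he
      have hsub : component (S.erase (root S h)) (root (S.erase (root S h)) he) ⊆ S :=
        (component_subset _ _).trans (Finset.erase_subset _ _)
      have hA0 : (component (S.erase (root S h)) (root (S.erase (root S h)) he)).Nonempty :=
        ⟨_, mem_component_self hr2⟩
      have hB0 : (S \ component (S.erase (root S h)) (root (S.erase (root S h)) he)).Nonempty :=
        ⟨_, Finset.mem_sdiff.2 ⟨hr, fun hm =>
          Finset.notMem_erase _ _ (component_subset _ _ hm)⟩⟩
      have hcomp : component ((S.map (chordEmb f)).erase (root (S.map (chordEmb f)) h'))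
          (root _ he') =
          (component (S.erase (root S h)) (root (S.erase (root S h)) he)).map (chordEmb f) := by
        rw [← component_map f hr2, ← root_map f hSe he (Finset.map_nonempty.2 he)]
        simp only [herase]
      rw [insertionTree_eq_insertAt h' he' hcomp (Finset.map_sdiff _ _).symm
          (Finset.map_nonempty.2 hA0) (Finset.map_nonempty.2 hB0),
        insertionTree_eq_insertAt h he rfl rfl hA0 hB0, hroot, chordEmb_snd,
        numEndpointsBelow_map, ih _ _ (hS.mono hsub) hA0 _ rfl,
        ih _ _ (hS.mono Finset.sdiff_subset) hB0 _ rfl, LeafTree.insertAt_map]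
      · exact Finset.card_lt_card (Finset.sdiff_ssubset hsub hA0)
      · exact lt_of_le_of_lt (Finset.card_le_card (component_subset _ _))
          (Finset.card_erase_lt_of_mem hr)
    · have he' : ¬ ((S.map (chordEmb f)).erase (root (S.map (chordEmb f)) h')).Nonempty := by
        rw [herase, Finset.map_nonempty]; exact he
      rw [insertionTree_of_card_eq_one h he, insertionTree_of_card_eq_one h' he', hroot]
      rfl

end Relabelling

/-! ### The root share decomposition of a set of chords. -/

section RootShare

variable {α : Type*} [LinearOrder α]

/-- `x` is an end point of `c`. -/
def IsEnd (x : α) (c : α × α) : Prop := x = c.1 ∨ x = c.2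

/-- The set `A ∪ B` of chords with root `r ∈ B` has the root share decomposition `B ∘ₖ A`. -/
structure RootShare (A B : Finset (α × α)) (r : α × α) : Prop where
  connA : Conn A
  connB : Conn B
  proper : Proper (A ∪ B)
  root_mem : r ∈ B
  root_le : ∀ c ∈ A ∪ B, r.1 ≤ c.1
  below : ∃ c ∈ A, c.1 < r.2
  above : ∃ c ∈ A, r.2 < c.2
  side : ∀ d ∈ B, ∀ z, IsEnd z d → z ≠ r.1 → ∀ c ∈ A, ∀ x, IsEnd x c →
    (x < z ∧ x < r.2) ∨ (z < x ∧ r.2 < x)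

namespace RootShare

variable {A B : Finset (α × α)} {r : α × α} (h : RootShare A B r)

include h

theorem lt_of_mem_left {c : α × α} (hc : c ∈ A) : r.1 < c.1 := by
  refine (h.root_le c (Finset.mem_union_left _ hc)).lt_of_ne fun e => ?_
  have hrc := h.proper.fst_inj _ (Finset.mem_union_right _ h.root_mem) _
    (Finset.mem_union_left _ hc) e
  subst hrc
  have hr := h.proper.lt _ (Finset.mem_union_left _ hc)
  have := h.side _ h.root_mem r.2 (Or.inr rfl) hr.ne' _ hc r.2 (Or.inr rfl)
  rcases this with h | h <;> exact lt_irrefl _ h.1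

theorem disjoint : Disjoint A B := by
  rw [Finset.disjoint_left]
  intro c hA hB
  have hr := h.lt_of_mem_left hA
  rcases h.side c hB c.1 (Or.inl rfl) hr.ne' c hA c.1 (Or.inl rfl) with h | h <;>
    exact lt_irrefl _ h.1

theorem root_lt {c : α × α} (hc : c ∈ B) (hcr : c ≠ r) : r.1 < c.1 :=
  (h.root_le c (Finset.mem_union_right _ hc)).lt_of_ne fun e => hcr
    (h.proper.fst_inj _ (Finset.mem_union_right _ hc) _ (Finset.mem_union_right _ h.root_mem)
      e.symm)

/-- By `side`, both end points of `d` lie in the gap of `A` that contains `r.2`, so no end point of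
`A` separates them. -/
theorem not_crosses {c d : α × α} (hc : c ∈ A) (hd : d ∈ B) (hdr : d ≠ r) :
    ¬ Crosses c d := by
  have h1 := h.root_lt hd hdr
  have h2 := h1.trans (h.proper.lt d (Finset.mem_union_right _ hd))
  have e1 := h.side d hd d.1 (Or.inl rfl) h1.ne' c hc
  have e2 := h.side d hd d.2 (Or.inr rfl) h2.ne' c hc
  have a1 := e1 c.1 (Or.inl rfl)
  have a2 := e1 c.2 (Or.inr rfl)
  have a3 := e2 c.1 (Or.inl rfl)
  have a4 := e2 c.2 (Or.inr rfl)
  rintro (⟨b1, b2, b3⟩ | ⟨b1, b2, b3⟩) <;> grind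

/-- Otherwise every chord of `A` lies entirely before or entirely after `r.2`. The chords before it
form a closed set, nonempty by `below` and proper by `above`, against the connectedness of `A`. -/
theorem exists_crosses_root : ∃ c ∈ A, Crosses r c := by
  classical
  by_contra! hno
  have hr := h.proper.lt _ (Finset.mem_union_right _ h.root_mem)
  have hside : ∀ c ∈ A, ∀ x, IsEnd x c → x < r.2 ∨ r.2 < x := fun c hc x hx =>
    (h.side r h.root_mem r.2 (Or.inr rfl) hr.ne' c hc x hx).imp And.right And.right
  have hcl : IsClosedIn (A.filter fun c => c.2 < r.2) A := by
    refine ⟨Finset.filter_subset _ _, fun x hx y hy hxy => ?_⟩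
    rw [Finset.mem_filter] at hx ⊢
    refine ⟨hy, ?_⟩
    have h1 := h.lt_of_mem_left hy
    have h2 := hno y hy
    have h3 := hside y hy y.2 (Or.inr rfl)
    have h4 := hside y hy y.1 (Or.inl rfl)
    unfold Crosses at hxy h2
    grind
  obtain ⟨c, hc, hc1⟩ := h.below
  obtain ⟨d, hd, hd1⟩ := h.above
  have h1 := h.lt_of_mem_left hc
  have h2 := hno c hc
  have h3 := hside c hc c.2 (Or.inr rfl)
  have hcm : c ∈ A.filter fun c => c.2 < r.2 := by
    rw [Finset.mem_filter]
    refine ⟨hc, ?_⟩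
    unfold Crosses at h2
    grind
  have := h.connA.2 _ hcl ⟨c, hcm⟩
  rw [← this, Finset.mem_filter] at hd
  exact lt_asymm hd1 hd.2

theorem conn : Conn (A ∪ B) := by
  classical
  obtain ⟨c, hc, hrc⟩ := h.exists_crosses_root
  refine ⟨⟨c, Finset.mem_union_left _ hc⟩, fun T hT hne => ?_⟩
  have key : ∀ X, X ⊆ A ∪ B → Conn X → (∃ x ∈ T, x ∈ X) → X ⊆ T := by
    rintro X hX hconn ⟨x, hxT, hxX⟩
    have := hconn.2 (T ∩ X) ⟨Finset.inter_subset_right, fun x hx y hy hxy => ?_⟩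
      ⟨x, Finset.mem_inter.2 ⟨hxT, hxX⟩⟩
    · rw [← this]; exact Finset.inter_subset_left
    · rw [Finset.mem_inter] at hx ⊢
      exact ⟨hT.2 x hx.1 y (hX hy) hxy, hy⟩
  have kA := key A Finset.subset_union_left h.connA
  have kB := key B Finset.subset_union_right h.connB
  have hAB : (∃ x ∈ T, x ∈ A) ↔ (∃ x ∈ T, x ∈ B) :=
    ⟨fun hx => ⟨r, hT.2 _ (kA hx hc) _ (Finset.mem_union_right _ h.root_mem) hrc.symm,
      h.root_mem⟩,
     fun hx => ⟨c, hT.2 _ (kB hx h.root_mem) _ (Finset.mem_union_left _ hc) hrc, hc⟩⟩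
  obtain ⟨x, hx⟩ := hne
  have hA : ∃ x ∈ T, x ∈ A := by
    rcases Finset.mem_union.1 (hT.1 hx) with hxA | hxB
    · exact ⟨x, hx, hxA⟩
    · exact hAB.2 ⟨x, hx, hxB⟩
  exact hT.1.antisymm (Finset.union_subset (kA hA) (kB (hAB.1 hA)))

theorem root_eq : root (A ∪ B) h.conn.1 = r :=
  h.proper.root_eq _ (Finset.mem_union_right _ h.root_mem) h.root_le

theorem root_right_eq : root B h.connB.1 = r :=
  (h.proper.mono Finset.subset_union_right).root_eq _ h.root_mem fun c hc =>
    h.root_le c (Finset.mem_union_right _ hc)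

theorem notMem_left : r ∉ A := fun hA => Finset.disjoint_left.1 h.disjoint hA h.root_mem

theorem erase_eq : (A ∪ B).erase r = A ∪ B.erase r := by
  rw [Finset.erase_union_distrib, Finset.erase_eq_of_notMem h.notMem_left]

theorem sdiff_eq : (A ∪ B) \ A = B := by
  rw [Finset.union_sdiff_left, Finset.sdiff_eq_self_iff_disjoint]
  exact h.disjoint.symm

theorem isClosedIn_erase : IsClosedIn A ((A ∪ B).erase r) := by
  rw [h.erase_eq]
  refine ⟨Finset.subset_union_left, fun x hx y hy hxy => ?_⟩
  rcases Finset.mem_union.1 hy with hy | hy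
  · exact hy
  · exact absurd hxy (h.not_crosses hx (Finset.mem_of_mem_erase hy) (Finset.ne_of_mem_erase hy))

theorem erase_nonempty : ((A ∪ B).erase r).Nonempty := by
  rw [h.erase_eq]
  exact h.connA.1.mono Finset.subset_union_left

/-- Some chord of `A` begins before `r.2`, hence before the gap that holds all of `B` except `r.1`.
So `A` is the first component, not just any component. -/
theorem root_erase_mem : root ((A ∪ B).erase r) h.erase_nonempty ∈ A := by
  obtain ⟨c, hc, hc1⟩ := h.below
  have hm := ChordDSE.root_mem _ h.erase_nonempty
  have hc' : c ∈ (A ∪ B).erase r := by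
    rw [h.erase_eq]; exact Finset.mem_union_left _ hc
  have hle := root_fst_le h.erase_nonempty hc'
  generalize root ((A ∪ B).erase r) h.erase_nonempty = d at hm hle
  rw [h.erase_eq] at hm
  rcases Finset.mem_union.1 hm with hd | hd
  · exact hd
  · exfalso
    have hdr := h.root_lt (Finset.mem_of_mem_erase hd) (Finset.ne_of_mem_erase hd)
    have := h.side d (Finset.mem_of_mem_erase hd) d.1 (Or.inl rfl) hdr.ne' c hc c.1 (Or.inl rfl)
    rcases this with e | e
    · exact absurd e.1 hle.not_gt
    · exact lt_asymm hc1 e.2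

theorem component_erase :
    component ((A ∪ B).erase r) (root ((A ∪ B).erase r) h.erase_nonempty) = A :=
  component_eq h.isClosedIn_erase h.connA h.root_erase_mem

/-- As `A` is the first component after removing `r`, it is listed right after `r`. The tail is the
one that also occurs in `intersectionOrder_right`, which lets labels in `A ∪ B` be compared with
labels in `B`. -/
theorem intersectionOrder_union : intersectionOrder (A ∪ B) =
    r :: (intersectionOrder A ++ intersectionOrder (B.erase r)) := by
  have hroot : root A h.connA.1 = root ((A ∪ B).erase r) h.erase_nonempty := by
    refine (h.proper.mono Finset.subset_union_left).root_eq _ h.root_erase_mem fun c hc => ?_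
    refine root_fst_le h.erase_nonempty ?_
    rw [h.erase_eq]
    exact Finset.mem_union_left _ hc
  rw [h.conn.intersectionOrder_eq, h.root_eq, intersectionOrder_eq_component_append
    h.erase_nonempty, h.component_erase, ← hroot, h.connA.intersectionOrder_eq]
  congr 3
  rw [h.erase_eq, Finset.union_sdiff_left]
  exact congrArg _ <| Finset.sdiff_eq_self_of_disjoint (h.disjoint.mono_right (Finset.erase_subset _ _)).symm

theorem intersectionOrder_right : intersectionOrder B = r :: intersectionOrder (B.erase r) := by
  rw [h.connB.intersectionOrder_eq, h.root_right_eq]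

theorem insertionTree_union : insertionTree (A ∪ B) h.conn.1 =
    LeafTree.insertAt (insertionTree B h.connB.1) (numEndpointsBelow A r.2)
      (insertionTree A h.connA.1) := by
  have he : ((A ∪ B).erase (root (A ∪ B) h.conn.1)).Nonempty := by
    rw [h.root_eq]; exact h.erase_nonempty
  rw [insertionTree_eq_insertAt h.conn.1 he _ h.sdiff_eq h.connA.1 h.connB.1, h.root_eq]
  have := h.component_erase
  simp only [h.root_eq]
  exact this

end RootShare

/-- A connected set of at least two chords has a root share decomposition. -/
theorem exists_rootShare {S : Finset (α × α)} (hS : Conn S) (hp : Proper S) (h2 : 2 ≤ S.card) :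
    ∃ A B r, S = A ∪ B ∧ RootShare A B r := by
  classical
  obtain ⟨r, hr, hrmin⟩ : ∃ r ∈ S, ∀ c ∈ S, r.1 ≤ c.1 :=
    ⟨root S hS.1, root_mem S hS.1, fun c hc => root_fst_le hS.1 hc⟩
  have hne : (S.erase r).Nonempty := by
    rw [← Finset.card_pos, Finset.card_erase_of_mem hr]; omega
  set m := root (S.erase r) hne with hm
  have hmS : m ∈ S.erase r := root_mem _ hne
  set A := component (S.erase r) m with hA
  have hAc : IsClosedIn A (S.erase r) := isClosedIn_component _ _
  have hAconn : Conn A := conn_component hmS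
  have hmA : m ∈ A := mem_component_self hmS
  have hAS : A ⊆ S := hAc.1.trans (Finset.erase_subset _ _)
  have hrA : r ∉ A := fun h => Finset.notMem_erase _ _ (hAc.1 h)
  have hrlt : ∀ c ∈ S, c ≠ r → r.1 < c.1 := fun c hc hcr =>
    (hrmin c hc).lt_of_ne fun e => hcr (hp.fst_inj _ hc _ hr e.symm)
  have hun : A ∪ S \ A = S := Finset.union_sdiff_of_subset hAS
  have hmle : ∀ c ∈ S, c ≠ r → m.1 ≤ c.1 := fun c hc hcr =>
    root_fst_le hne (Finset.mem_erase.2 ⟨hcr, hc⟩)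
  -- every component of `S.erase r` contains a chord crossing the root
  have hcross : ∀ T, IsClosedIn T (S.erase r) → T.Nonempty → ∃ c ∈ T, Crosses r c := by
    intro T hT hT0
    by_contra! hno
    have hcl : IsClosedIn T S := by
      refine ⟨hT.1.trans (Finset.erase_subset _ _), fun x hx y hy hxy => ?_⟩
      by_cases hyr : y = r
      · subst hyr; exact absurd hxy.symm (hno x hx)
      · exact hT.2 x hx y (Finset.mem_erase.2 ⟨hyr, hy⟩) hxy
    have := hS.2 T hcl hT0
    rw [← this] at hr
    exact Finset.notMem_erase _ _ (hT.1 hr)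
  have hr12 := hp.lt r hr
  obtain ⟨a, haA, hra⟩ := hcross A hAc hAconn.1
  have ha : a.1 < r.2 ∧ r.2 < a.2 := by
    have := hrlt a (hAS haA) (fun e => hrA (e ▸ haA))
    unfold Crosses at hra
    grind
  -- the points of `A` are outside of every chord that does not cross `A`
  have hout : ∀ d ∈ S \ A, d ≠ r → ∀ c ∈ A, ∀ x, IsEnd x c →
      (x < d.1 ∧ x < d.2) ∨ (d.1 < x ∧ d.2 < x) := by
    intro d hd hdr
    rw [Finset.mem_sdiff] at hd
    have hd12 := hp.lt d hd.1
    have hnc : ∀ c ∈ A, ¬ Crosses c d := fun c hc hx =>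
      hd.2 (hAc.2 c hc d (Finset.mem_erase.2 ⟨hdr, hd.1⟩) hx)
    have hdist : ∀ c ∈ A, c.1 ≠ d.1 ∧ c.2 ≠ d.2 ∧ c.1 ≠ d.2 ∧ c.2 ≠ d.1 := fun c hc =>
      ⟨fun e => hd.2 (hp.fst_inj _ (hAS hc) _ hd.1 e ▸ hc),
        fun e => hd.2 (hp.snd_inj _ (hAS hc) _ hd.1 e ▸ hc),
        hp.fst_ne_snd _ (hAS hc) _ hd.1, (hp.fst_ne_snd _ hd.1 _ (hAS hc)).symm⟩
    -- No chord of `A` crosses `d`, so it begins inside `d` only if it lies inside `d`, and such a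
    -- chord crosses none that begins outside. Connectedness makes "begins outside" constant on `A`;
    -- the root `m` of `A` begins outside.
    have hcl : IsClosedIn (A.filter fun c => (c.1 < d.1 ∨ d.2 < c.1)) A := by
      refine ⟨Finset.filter_subset _ _, fun x hx y hy hxy => ?_⟩
      rw [Finset.mem_filter] at hx ⊢
      refine ⟨hy, ?_⟩
      have h1 := hnc x hx.1
      have h2 := hnc y hy
      have h3 := hdist x hx.1
      have h4 := hdist y hy
      have h5 := hp.lt x (hAS hx.1)
      have h6 := hp.lt y (hAS hy)
      unfold Crosses at h1 h2 hxy
      grind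
    have hmlt : m.1 < d.1 := (hmle d hd.1 hdr).lt_of_ne (hdist m hmA).1
    have hall := hAconn.2 _ hcl ⟨m, Finset.mem_filter.2 ⟨hmA, Or.inl hmlt⟩⟩
    intro c hc x hx
    have h1 := hc
    rw [← hall, Finset.mem_filter] at h1
    have h2 := hnc c hc
    have h3 := hdist c hc
    have h4 := hp.lt c (hAS hc)
    unfold Crosses at h2
    unfold IsEnd at hx
    grind
  have hAr : ∀ c ∈ A, c.1 ≠ r.2 ∧ c.2 ≠ r.2 := fun c hc =>
    ⟨hp.fst_ne_snd _ (hAS hc) _ hr, fun e => hrA (hp.snd_inj _ (hAS hc) _ hr e ▸ hc)⟩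
  have hcomp : ∀ d ∈ S \ A, d ≠ r → component (S.erase r) d ⊆ S \ A := by
    intro d hd hdr
    rw [Finset.mem_sdiff] at hd
    have : IsClosedIn (S.erase r \ A) (S.erase r) := by
      refine ⟨Finset.sdiff_subset, fun x hx y hy hxy => ?_⟩
      rw [Finset.mem_sdiff] at hx ⊢
      exact ⟨hy, fun hyA => hx.2 (hAc.2 y hyA x hx.1 hxy.symm)⟩
    exact (component_subset_of_isClosedIn this
      (Finset.mem_sdiff.2 ⟨Finset.mem_erase.2 ⟨hdr, hd.1⟩, hd.2⟩)).trans
      (Finset.sdiff_subset_sdiff (Finset.erase_subset _ _) subset_rfl)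
  refine ⟨A, S \ A, r, hun.symm, ⟨hAconn, ?_, hun.symm ▸ hp, Finset.mem_sdiff.2 ⟨hr, hrA⟩,
    hun.symm ▸ hrmin, ⟨a, haA, ha.1⟩, ⟨a, haA, ha.2⟩, ?_⟩⟩
  · refine ⟨⟨r, Finset.mem_sdiff.2 ⟨hr, hrA⟩⟩, fun T hT hT0 => ?_⟩
    -- A closed set avoiding `r` would be closed in `S.erase r`, and so contain a chord crossing
    -- `r`. Once `r ∈ T`, the set `A ∪ T` is closed in `S`, hence all of `S`.
    have hTr : r ∈ T := by
      by_contra hrT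
      have hcl : IsClosedIn T (S.erase r) := by
        refine ⟨fun x hx => Finset.mem_erase.2 ⟨fun e => hrT (e ▸ hx),
          (Finset.mem_sdiff.1 (hT.1 hx)).1⟩, fun x hx y hy hxy => ?_⟩
        refine hT.2 x hx y (Finset.mem_sdiff.2 ⟨Finset.mem_of_mem_erase hy, fun hyA => ?_⟩) hxy
        have hxS := Finset.mem_sdiff.1 (hT.1 hx)
        exact hxS.2 (hAc.2 y hyA x (Finset.mem_erase.2 ⟨fun e => hrT (e ▸ hx), hxS.1⟩) hxy.symm)
      obtain ⟨c, hcT, hrc⟩ := hcross T hcl hT0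
      exact hrT (hT.2 c hcT r (Finset.mem_sdiff.2 ⟨hr, hrA⟩) hrc.symm)
    have hcl : IsClosedIn (A ∪ T) S := by
      refine ⟨Finset.union_subset hAS (hT.1.trans Finset.sdiff_subset), fun x hx y hy hxy => ?_⟩
      rw [Finset.mem_union] at hx ⊢
      by_contra! hy'
      have hyr : y ≠ r := fun e => hy'.2 (e ▸ hTr)
      rcases hx with hx | hx
      · exact hy'.1 (hAc.2 x hx y (Finset.mem_erase.2 ⟨hyr, hy⟩) hxy)
      · exact hy'.2 (hT.2 x hx y (Finset.mem_sdiff.2 ⟨hy, hy'.1⟩) hxy)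
    have := hS.2 _ hcl ⟨r, Finset.mem_union_right _ hTr⟩
    refine hT.1.antisymm fun x hx => ?_
    rw [Finset.mem_sdiff, ← this, Finset.mem_union] at hx
    tauto
  · intro d hd z hz hzr c hc x hx
    by_cases hdr : d = r
    · subst hdr
      have := hAr c hc
      have : z = d.2 := hz.resolve_left hzr
      subst this
      rcases lt_trichotomy x d.2 with h | h | h
      · exact Or.inl ⟨h, h⟩
      · unfold IsEnd at hx; grind
      · exact Or.inr ⟨h, h⟩
    · set E := component (S.erase r) d with hE
      have hdE : d ∈ S.erase r := Finset.mem_erase.2 ⟨hdr, (Finset.mem_sdiff.1 hd).1⟩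
      have hEconn : Conn E := conn_component hdE
      have hES : E ⊆ S \ A := hcomp d hd hdr
      have hEc : IsClosedIn E (S.erase r) := isClosedIn_component _ _
      have hEr : ∀ e ∈ E, e ≠ r := fun e he => Finset.ne_of_mem_erase (hEc.1 he)
      obtain ⟨e, heE, hre⟩ := hcross E hEc hEconn.1
      have he : e.1 < r.2 ∧ r.2 < e.2 := by
        have := hrlt e (Finset.mem_sdiff.1 (hES heE)).1 (hEr e heE)
        unfold Crosses at hre
        grind
      have hxe := hout e (hES heE) (hEr e heE) c hc x hx
      -- The point `x` of `A` lies outside every chord of `E`, so its side is constant along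
      -- crossings. For `e`, which crosses `r`, that side is also the side of `x` relative to `r.2`;
      -- connectedness carries this from `e` to `d`.
      have hcl : IsClosedIn (E.filter fun f => (x < f.1 ↔ x < r.2)) E := by
        refine ⟨Finset.filter_subset _ _, fun f hf g hg hfg => ?_⟩
        rw [Finset.mem_filter] at hf ⊢
        refine ⟨hg, ?_⟩
        have h1 := hout f (hES hf.1) (hEr f hf.1) c hc x hx
        have h2 := hout g (hES hg) (hEr g hg) c hc x hx
        unfold Crosses at hfg
        grind
      have heq := hEconn.2 _ hcl ⟨e, Finset.mem_filter.2 ⟨heE, by grind⟩⟩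
      have hdm : d ∈ E := mem_component_self hdE
      have hxd := hout d hd hdr c hc x hx
      rw [← heq, Finset.mem_filter] at hdm
      unfold IsEnd at hz
      have := hAr c hc
      unfold IsEnd at hx
      grind

end RootShare

/-! ### Interleaving the end points of two diagrams. -/

section JoinEmbeddings

/-- The positions of the end points of `C'` in `C' ∘ₖ₊₁ C''`. -/
def joinLeft (p q : ℕ) (k : Fin (2 * q - 1)) : Fin (2 * p) ↪o Fin (2 * (p + q)) :=
  OrderEmbedding.ofStrictMono
    (fun i => if h : i.1 = 0 then ⟨0, by omega⟩ else ⟨i + (k + 1), by omega⟩)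
    (fun i j hij => by
      rw [Fin.lt_def] at hij ⊢
      dsimp only
      split_ifs <;> simp only [] <;> omega)

/-- The positions of the end points of `C''` in `C' ∘ₖ₊₁ C''`. -/
def joinRight (p q : ℕ) (k : Fin (2 * q - 1)) : Fin (2 * q) ↪o Fin (2 * (p + q)) :=
  OrderEmbedding.ofStrictMono
    -- For `p = 0` the shift by one would collide with the unshifted points; the condition `0 < p`
    -- keeps the map strictly monotone.
    (fun i => if h : i.1 < k + 1 ∧ 0 < p then ⟨i + 1, by omega⟩ else ⟨i + 2 * p, by omega⟩)
    (fun i j hij => by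
      rw [Fin.lt_def] at hij ⊢
      dsimp only
      split_ifs <;> simp only [] <;> omega)

theorem joinLeft_val (p q : ℕ) (k : Fin (2 * q - 1)) (i : Fin (2 * p)) :
    (joinLeft p q k i : ℕ) = if i.1 = 0 then 0 else i.1 + (k.1 + 1) := by
  change ((if h : i.1 = 0 then ⟨0, _⟩ else ⟨i + (k + 1), _⟩ : Fin (2 * (p + q))) : ℕ) = _
  split_ifs <;> rfl

theorem joinRight_val {p : ℕ} (hp : 0 < p) (q : ℕ) (k : Fin (2 * q - 1)) (i : Fin (2 * q)) :
    (joinRight p q k i : ℕ) = if i.1 < k.1 + 1 then i.1 + 1 else i.1 + 2 * p := by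
  change ((if h : i.1 < k + 1 ∧ 0 < p then ⟨i + 1, _⟩ else ⟨i + 2 * p, _⟩ :
    Fin (2 * (p + q))) : ℕ) = _
  simp only [hp, and_true]
  split_ifs <;> rfl

theorem joinLeft_ne_joinRight {p q : ℕ} {k : Fin (2 * q - 1)} (i : Fin (2 * p))
    (j : Fin (2 * q)) : joinLeft p q k i ≠ joinRight p q k j := by
  have hp : 0 < p := by have := i.2; omega
  rw [Ne, Fin.ext_iff, joinLeft_val, joinRight_val hp]
  intro h
  split_ifs at h <;> omega

theorem bijective_sumElim {p q : ℕ} {e : Fin (2 * p) ↪o Fin (2 * (p + q))}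
    {f : Fin (2 * q) ↪o Fin (2 * (p + q))} (h : ∀ i j, e i ≠ f j) :
    Function.Bijective (Sum.elim e f) := by
  rw [Fintype.bijective_iff_injective_and_card]
  refine ⟨e.injective.sumElim f.injective h, ?_⟩
  simp
  omega

/-- The distribution of the end points of `C' ∘ₖ₊₁ C''` to `C'` and `C''`. -/
def joinEquiv (p q : ℕ) (k : Fin (2 * q - 1)) : Fin (2 * p) ⊕ Fin (2 * q) ≃ Fin (2 * (p + q)) :=
  Equiv.ofBijective _ (bijective_sumElim (joinLeft_ne_joinRight (k := k)))

theorem joinEquiv_inl (p q : ℕ) (k : Fin (2 * q - 1)) (i : Fin (2 * p)) :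
    joinEquiv p q k (Sum.inl i) = joinLeft p q k i := rfl

theorem joinEquiv_inr (p q : ℕ) (k : Fin (2 * q - 1)) (i : Fin (2 * q)) :
    joinEquiv p q k (Sum.inr i) = joinRight p q k i := rfl

/-- A position is the number of points below it. Counting these separately in the two ranges
determines complementary embeddings from their interlacing alone. -/
theorem val_eq_card_add_card {p q : ℕ} {e : Fin (2 * p) ↪o Fin (2 * (p + q))}
    {f : Fin (2 * q) ↪o Fin (2 * (p + q))} (h : ∀ i j, e i ≠ f j) (x : Fin (2 * (p + q))) :
    (x : ℕ) = (Finset.univ.filter fun i => e i < x).card +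
      (Finset.univ.filter fun j => f j < x).card := by
  have h1 : (x : ℕ) = ∑ y : Fin (2 * (p + q)), if y < x then 1 else 0 := by
    rw [← Finset.card_filter]
    have : Finset.univ.filter (fun y => y < x) = Finset.Iio x := by ext; simp
    rw [this, Fin.card_Iio]
  rw [h1, ← (Equiv.ofBijective _ (bijective_sumElim h)).sum_comp, Fintype.sum_sum_type,
    Finset.card_filter, Finset.card_filter]
  rfl

/-- Complementary order embeddings whose ranges interlace as those of `joinLeft` and `joinRight`
are equal to them. -/
theorem eq_join_of_interlace {p q : ℕ} {e : Fin (2 * p) ↪o Fin (2 * (p + q))}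
    {f : Fin (2 * q) ↪o Fin (2 * (p + q))} {y : Fin (2 * (p + q))}
    (hlt : ∀ i : Fin (2 * p), i.1 = 0 → ∀ j, e i < f j)
    (hside : ∀ i : Fin (2 * p), i.1 ≠ 0 → ∀ j, (f j < e i ∧ f j < y) ∨ (e i < f j ∧ y < f j))
    (hp : 0 < p) (hbelow : ∃ j, f j < y) (habove : ∃ j, y < f j) :
    ∃ k : Fin (2 * q - 1), e = joinLeft p q k ∧ f = joinRight p q k := by
  have hne : ∀ i j, e i ≠ f j := by
    intro i j
    by_cases hi : i.1 = 0
    · exact (hlt i hi j).ne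
    · rcases hside i hi j with h | h
      exacts [h.1.ne', h.1.ne]
  have hey : ∀ j, f j < y ∨ y < f j := fun j =>
    (hside ⟨1, by omega⟩ (by simp) j).imp And.right And.right
  set kk := (Finset.univ.filter fun j => f j < y).card with hkk
  have hf : ∀ j : Fin (2 * q), (f j : ℕ) = (Finset.univ.filter fun i => e i < f j).card + j := by
    intro j
    conv_lhs => rw [val_eq_card_add_card hne (f j)]
    congr 1
    have : Finset.univ.filter (fun i => f i < f j) = Finset.Iio j := by ext; simp
    rw [this, Fin.card_Iio]
  have he : ∀ i : Fin (2 * p), (e i : ℕ) = i + (Finset.univ.filter fun j => f j < e i).card := by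
    intro i
    conv_lhs => rw [val_eq_card_add_card hne (e i)]
    congr 1
    have : Finset.univ.filter (fun j => e j < e i) = Finset.Iio i := by ext; simp
    rw [this, Fin.card_Iio]
  -- By monotonicity of `f`, the points of `f` below `y` are the first `kk`.
  have hmono : ∀ j, f j < y ↔ j.1 < kk := by
    intro j
    constructor
    · intro hj
      have : Finset.Iic j ⊆ Finset.univ.filter fun j => f j < y := by
        intro i hi
        rw [Finset.mem_Iic] at hi
        simp only [Finset.mem_filter, Finset.mem_univ, true_and]
        exact lt_of_le_of_lt (f.le_iff_le.2 hi) hj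
      have := Finset.card_le_card this
      rw [Fin.card_Iic] at this
      omega
    · intro hj
      by_contra hjy
      have hjy := (hey j).resolve_left hjy
      have : (Finset.univ.filter fun j => f j < y) ⊆ Finset.Iio j := by
        intro i hi
        simp only [Finset.mem_filter, Finset.mem_univ, true_and] at hi
        rw [Finset.mem_Iio]
        exact f.lt_iff_lt.1 (hi.trans hjy)
      have := Finset.card_le_card this
      rw [Fin.card_Iio] at this
      omega
  obtain ⟨j0, hj0⟩ := hbelow
  obtain ⟨j1, hj1⟩ := habove
  have h0 := (hmono j0).1 hj0
  have h1 : ¬ j1.1 < kk := fun h => lt_asymm hj1 ((hmono j1).2 h)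
  -- `hbelow` and `habove` give `1 ≤ kk ≤ 2q - 1`, so `kk - 1` is the zero-based index of the gap.
  have hkq : kk - 1 < 2 * q - 1 := by have := j1.2; omega
  have hk1 : kk - 1 + 1 = kk := by omega
  refine ⟨⟨kk - 1, hkq⟩, ?_, ?_⟩
  · ext i
    rw [he, joinLeft_val]
    split_ifs with hi
    · have : Finset.univ.filter (fun j => f j < e i) = ∅ := by
        rw [Finset.filter_eq_empty_iff]
        exact fun j _ => (hlt i hi j).asymm
      rw [this, hi, Finset.card_empty]
    · have : Finset.univ.filter (fun j => f j < e i) = Finset.univ.filter (fun j => f j < y) := by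
        ext j
        simp only [Finset.mem_filter, Finset.mem_univ, true_and]
        rcases hside i hi j with h | h
        · exact iff_of_true h.1 h.2
        · exact iff_of_false h.1.asymm h.2.asymm
      rw [this, ← hkk]
      simp only [hk1]
  · ext j
    rw [hf, joinRight_val hp]
    simp only [hk1]
    split_ifs with hj
    · have : Finset.univ.filter (fun i => e i < f j) = {⟨0, by omega⟩} := by
        ext i
        simp only [Finset.mem_filter, Finset.mem_univ, true_and, Finset.mem_singleton,
          Fin.ext_iff]
        constructor
        · intro h
          by_contra hi
          rcases hside i hi j with h' | h'
          · exact lt_asymm h h'.1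
          · exact lt_asymm h'.2 ((hmono j).2 hj)
        · exact fun hi => hlt i hi j
      rw [this, Finset.card_singleton, add_comm]
    · have : Finset.univ.filter (fun i => e i < f j) = Finset.univ := by
        ext i
        simp only [Finset.mem_filter, Finset.mem_univ, true_and, iff_true]
        by_cases hi : i.1 = 0
        · exact hlt i hi j
        · rcases hside i hi j with h' | h'
          · exact absurd ((hmono j).1 h'.2) hj
          · exact h'.1
      rw [this, Finset.card_univ, Fintype.card_fin, add_comm]

end JoinEmbeddings

/-! ### Composition of chord diagrams and the decomposition theorem. -/

namespace ChordDiagram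

variable {n p q : ℕ}

theorem mem_chords {C : ChordDiagram n} {c : Fin (2 * n) × Fin (2 * n)} :
    c ∈ C.chords ↔ c.1 < c.2 ∧ C.perm c.1 = c.2 := by
  simp [chords]

theorem perm_snd {C : ChordDiagram n} {c : Fin (2 * n) × Fin (2 * n)} (hc : c ∈ C.chords) :
    C.perm c.2 = c.1 := by
  rw [← (mem_chords.1 hc).2, C.involutive]

theorem proper_chords (C : ChordDiagram n) : Proper C.chords where
  lt c hc := (mem_chords.1 hc).1
  fst_inj c hc d hd h := Prod.ext h (by
    rw [← (mem_chords.1 hc).2, ← (mem_chords.1 hd).2, h])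
  snd_inj c hc d hd h := Prod.ext (by rw [← perm_snd hc, ← perm_snd hd, h]) h
  fst_ne_snd c hc d hd h := by
    have h1 : c.2 = d.1 := by rw [← (mem_chords.1 hc).2, h, perm_snd hd]
    have h2 := (mem_chords.1 hc).1
    have h3 := (mem_chords.1 hd).1
    rw [h, h1] at h2
    exact lt_asymm h2 h3

theorem exists_isEnd (C : ChordDiagram n) (x : Fin (2 * n)) : ∃ c ∈ C.chords, IsEnd x c := by
  rcases lt_or_gt_of_ne (C.fixedPointFree x) with h | h
  · exact ⟨(C.perm x, x), mem_chords.2 ⟨h, C.involutive x⟩, Or.inr rfl⟩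
  · exact ⟨(x, C.perm x), mem_chords.2 ⟨h, rfl⟩, Or.inl rfl⟩

theorem ext_chords {C C' : ChordDiagram n} (h : C.chords = C'.chords) : C = C' := by
  have : C.perm = C'.perm := by
    ext1 x
    obtain ⟨c, hc, hx⟩ := C.exists_isEnd x
    have hc' := h ▸ hc
    rcases hx with rfl | rfl
    · rw [(mem_chords.1 hc).2, (mem_chords.1 hc').2]
    · rw [perm_snd hc, perm_snd hc']
  cases C; cases C'; cases this; rfl

/-- Every point is an end point of exactly one chord, so counting end points of a full diagram is
counting points. -/
theorem card_fst_add_card_snd (C : ChordDiagram n) (P : Fin (2 * n) → Prop) [DecidablePred P] :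
    (C.chords.filter fun c => P c.1).card + (C.chords.filter fun c => P c.2).card =
      (Finset.univ.filter P).card := by
  have h1 : (C.chords.filter fun c => P c.1).card =
      ((Finset.univ.filter P).filter fun i => i < C.perm i).card := by
    refine Finset.card_bij (fun c _ => c.1) ?_ ?_ ?_
    · intro c hc
      rw [Finset.mem_filter, mem_chords] at hc
      simp only [Finset.mem_filter, Finset.mem_univ, true_and]
      exact ⟨hc.2, hc.1.2 ▸ hc.1.1⟩
    · intro c hc d hd h
      exact C.proper_chords.fst_inj c (Finset.mem_of_mem_filter c hc) d
        (Finset.mem_of_mem_filter d hd) h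
    · intro i hi
      simp only [Finset.mem_filter, Finset.mem_univ, true_and] at hi
      exact ⟨(i, C.perm i), by simp [chords, hi], rfl⟩
  have h2 : (C.chords.filter fun c => P c.2).card =
      ((Finset.univ.filter P).filter fun i => ¬ i < C.perm i).card := by
    refine Finset.card_bij (fun c _ => c.2) ?_ ?_ ?_
    · intro c hc
      rw [Finset.mem_filter] at hc
      simp only [Finset.mem_filter, Finset.mem_univ, true_and]
      exact ⟨hc.2, by rw [perm_snd hc.1]; exact (mem_chords.1 hc.1).1.asymm⟩
    · intro c hc d hd h
      exact C.proper_chords.snd_inj c (Finset.mem_of_mem_filter c hc) d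
        (Finset.mem_of_mem_filter d hd) h
    · intro i hi
      simp only [Finset.mem_filter, Finset.mem_univ, true_and, not_lt] at hi
      refine ⟨(C.perm i, i), ?_, rfl⟩
      rw [Finset.mem_filter, mem_chords]
      exact ⟨⟨lt_of_le_of_ne hi.2 (C.fixedPointFree i), C.involutive i⟩, hi.1⟩
  rw [h1, h2, Finset.card_filter_add_card_filter_not]

/-- The diagram `C' ∘ₖ₊₁ C''`. -/
def join (C' : ChordDiagram p) (C'' : ChordDiagram q) (k : Fin (2 * q - 1)) :
    ChordDiagram (p + q) where
  perm := (joinEquiv p q k).symm.trans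
    ((Equiv.sumCongr C'.perm C''.perm).trans (joinEquiv p q k))
  involutive i := by
    obtain ⟨x, rfl⟩ := (joinEquiv p q k).surjective i
    rcases x with x | x <;> simp [C'.involutive, C''.involutive]
  fixedPointFree i := by
    obtain ⟨x, rfl⟩ := (joinEquiv p q k).surjective i
    rcases x with x | x <;> simp [C'.fixedPointFree, C''.fixedPointFree]

theorem join_perm_left (C' : ChordDiagram p) (C'' : ChordDiagram q) (k : Fin (2 * q - 1))
    (x : Fin (2 * p)) : (C'.join C'' k).perm (joinLeft p q k x) = joinLeft p q k (C'.perm x) := by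
  rw [← joinEquiv_inl, ← joinEquiv_inl]
  simp [join]

theorem join_perm_right (C' : ChordDiagram p) (C'' : ChordDiagram q) (k : Fin (2 * q - 1))
    (x : Fin (2 * q)) :
    (C'.join C'' k).perm (joinRight p q k x) = joinRight p q k (C''.perm x) := by
  rw [← joinEquiv_inr, ← joinEquiv_inr]
  simp [join]

theorem chords_join (C' : ChordDiagram p) (C'' : ChordDiagram q) (k : Fin (2 * q - 1)) :
    (C'.join C'' k).chords = C''.chords.map (chordEmb (joinRight p q k)) ∪
      C'.chords.map (chordEmb (joinLeft p q k)) := by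
  ext ⟨x, y⟩
  simp only [Finset.mem_union, Finset.mem_map, mem_chords]
  constructor
  · rintro ⟨hxy, rfl⟩
    obtain ⟨z, rfl⟩ := (joinEquiv p q k).surjective x
    rcases z with z | z
    · rw [joinEquiv_inl, join_perm_left] at hxy ⊢
      exact Or.inr ⟨(z, C'.perm z), ⟨(joinLeft p q k).lt_iff_lt.1 hxy, rfl⟩, rfl⟩
    · rw [joinEquiv_inr, join_perm_right] at hxy ⊢
      exact Or.inl ⟨(z, C''.perm z), ⟨(joinRight p q k).lt_iff_lt.1 hxy, rfl⟩, rfl⟩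
  · rintro (⟨⟨u, v⟩, ⟨h1, h2⟩, h3⟩ | ⟨⟨u, v⟩, ⟨h1, h2⟩, h3⟩) <;> dsimp only at h1 h2 <;> subst h2 <;>
      obtain ⟨rfl, rfl⟩ := Prod.mk.inj h3
    · exact ⟨(joinRight p q k).lt_iff_lt.2 h1, join_perm_right ..⟩
    · exact ⟨(joinLeft p q k).lt_iff_lt.2 h1, join_perm_left ..⟩

theorem pos_of_conn {C : ChordDiagram n} (h : Conn C.chords) : 0 < n := by
  rw [← C.card_chords]
  exact Finset.card_pos.2 h.1

theorem root_fst (C : ChordDiagram n) (h : C.chords.Nonempty) : (root C.chords h).1.1 = 0 := by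
  have hr := root_mem _ h
  have hn : 0 < 2 * n := (root C.chords h).1.pos
  obtain ⟨c, hc, h0⟩ := C.exists_isEnd ⟨0, hn⟩
  have h1 := root_fst_le h hc
  have h2 := (mem_chords.1 hc).1
  rw [Fin.le_def] at h1
  rw [Fin.lt_def] at h2
  rcases h0 with h0 | h0
  · rw [← h0] at h1
    exact Nat.le_zero.1 h1
  · rw [← h0] at h2
    exact absurd h2 (Nat.not_lt_zero _)

/-- The first point of `C''` lands right after the first end point of the root and its last point at
the very end; these witness `below` and `above`. -/
theorem rootShare_join {C' : ChordDiagram p} {C'' : ChordDiagram q} (hC' : Conn C'.chords)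
    (hC'' : Conn C''.chords) (k : Fin (2 * q - 1)) :
    RootShare (C''.chords.map (chordEmb (joinRight p q k)))
      (C'.chords.map (chordEmb (joinLeft p q k)))
      (chordEmb (joinLeft p q k) (root C'.chords hC'.1)) := by
  have hp := pos_of_conn hC'
  have hq := pos_of_conn hC''
  have hr0 := C'.root_fst hC'.1
  have hr := root_mem _ hC'.1
  have hr1 := (mem_chords.1 hr).1
  rw [Fin.lt_def] at hr1
  generalize root C'.chords hC'.1 = r at *
  refine ⟨(conn_map_iff _).2 hC'', (conn_map_iff _).2 hC', chords_join C' C'' k ▸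
    (C'.join C'' k).proper_chords, Finset.mem_map_of_mem _ hr, fun c _ => ?_, ?_, ?_, ?_⟩
  · rw [chordEmb_fst, Fin.le_def, joinLeft_val, if_pos hr0]
    exact Nat.zero_le _
  · obtain ⟨c, hc, h0⟩ := C''.exists_isEnd ⟨0, by omega⟩
    have h2 := (mem_chords.1 hc).1
    rw [Fin.lt_def] at h2
    have h1 : c.1.1 = 0 := by
      rcases h0 with h0 | h0
      · rw [← h0]
      · rw [← h0] at h2
        exact absurd h2 (Nat.not_lt_zero _)
    refine ⟨_, Finset.mem_map_of_mem _ hc, ?_⟩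
    rw [chordEmb_fst, chordEmb_snd, Fin.lt_def, joinRight_val hp, joinLeft_val, if_pos (by omega),
      if_neg (by omega)]
    omega
  · obtain ⟨c, hc, h0⟩ := C''.exists_isEnd ⟨2 * q - 1, by omega⟩
    have h2 := (mem_chords.1 hc).1
    rw [Fin.lt_def] at h2
    have h1 : c.2.1 = 2 * q - 1 := by
      rcases h0 with h0 | h0
      · rw [← h0] at h2
        simp only [] at h2
        omega
      · rw [← h0]
    refine ⟨_, Finset.mem_map_of_mem _ hc, ?_⟩
    rw [chordEmb_snd, chordEmb_snd, Fin.lt_def, joinRight_val hp, joinLeft_val, if_neg (by omega),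
      if_neg (by omega)]
    omega
  · simp only [Finset.mem_map]
    rintro _ ⟨d, -, rfl⟩ z hz hzr _ ⟨c, -, rfl⟩ x hx
    obtain ⟨i, rfl⟩ : ∃ i, z = joinLeft p q k i := by
      rcases hz with rfl | rfl <;> exact ⟨_, rfl⟩
    obtain ⟨j, rfl⟩ : ∃ j, x = joinRight p q k j := by
      rcases hx with rfl | rfl <;> exact ⟨_, rfl⟩
    have hi : i.1 ≠ 0 := fun h => hzr (by
      rw [chordEmb_fst, Fin.ext_iff, joinLeft_val, joinLeft_val, if_pos h, if_pos hr0])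
    simp only [chordEmb_snd, Fin.lt_def, joinRight_val hp, joinLeft_val, if_neg hi]
    rw [if_neg (show (r.2 : ℕ) ≠ 0 by omega)]
    split_ifs <;> omega

theorem conn_join {C' : ChordDiagram p} {C'' : ChordDiagram q} (hC' : Conn C'.chords)
    (hC'' : Conn C''.chords) (k : Fin (2 * q - 1)) : Conn (C'.join C'' k).chords := by
  rw [chords_join]
  exact (rootShare_join hC' hC'' k).conn

/-- The insertion index can be read off from the composed diagram. This matches the edge number in
the tree recursion and gives uniqueness of the decomposition. -/
theorem numEndpointsBelow_joinRight {C' : ChordDiagram p} (C'' : ChordDiagram q)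
    (h' : C'.chords.Nonempty) (k : Fin (2 * q - 1)) :
    numEndpointsBelow (C''.chords.map (chordEmb (joinRight p q k)))
      (joinLeft p q k (root C'.chords h').2) = k + 1 := by
  have hr0 := C'.root_fst h'
  have hr1 := (mem_chords.1 (root_mem _ h')).1
  rw [Fin.lt_def] at hr1
  generalize root C'.chords h' = r at *
  have hp : 0 < p := by omega
  rw [numEndpointsBelow, Finset.filter_map, Finset.filter_map, Finset.card_map, Finset.card_map]
  refine (C''.card_fst_add_card_snd fun x => joinRight p q k x < joinLeft p q k r.2).trans ?_
  have : (Finset.univ.filter fun x => joinRight p q k x < joinLeft p q k r.2) =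
      Finset.Iio (⟨k + 1, by omega⟩ : Fin (2 * q)) := by
    ext x
    simp only [Finset.mem_filter, Finset.mem_univ, true_and, Finset.mem_Iio, Fin.lt_def,
      joinRight_val hp, joinLeft_val]
    rw [if_neg (show (r.2 : ℕ) ≠ 0 by omega)]
    split_ifs <;> omega
  rw [this, Fin.card_Iio]

/-- Every set of chords is the image of a diagram under an order embedding. -/
theorem exists_eq_map_chords {α : Type*} [LinearOrder α] {S : Finset (α × α)} (hS : Proper S)
    {n : ℕ} (hn : S.card = n) :
    ∃ (C : ChordDiagram n) (e : Fin (2 * n) ↪o α), S = C.chords.map (chordEmb e) := by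
  classical
  have hP : (S.image Prod.fst ∪ S.image Prod.snd).card = 2 * n := by
    rw [Finset.card_union_of_disjoint, Finset.card_image_of_injOn, Finset.card_image_of_injOn, hn,
      two_mul]
    · exact fun c hc d hd h => hS.snd_inj c hc d hd h
    · exact fun c hc d hd h => hS.fst_inj c hc d hd h
    · rw [Finset.disjoint_left]
      simp only [Finset.mem_image]
      rintro _ ⟨c, hc, rfl⟩ ⟨d, hd, h⟩
      exact hS.fst_ne_snd c hc d hd h.symm
  set P := S.image Prod.fst ∪ S.image Prod.snd with hPdef
  -- The embedding is the increasing enumeration of all end points; the involution `σ` below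
  -- exchanges the two ends of each chord.
  set e := P.orderEmbOfFin hP with he
  have hmem : ∀ x, x ∈ P ↔ ∃ i, e i = x := fun x => by
    rw [← Set.mem_range, he, Finset.range_orderEmbOfFin, Finset.mem_coe]
  have hex : ∀ i, ∃ j, (e i, e j) ∈ S ∨ (e j, e i) ∈ S := by
    intro i
    have := (hmem (e i)).2 ⟨i, rfl⟩
    rw [hPdef, Finset.mem_union, Finset.mem_image, Finset.mem_image] at this
    rcases this with ⟨c, hc, h⟩ | ⟨c, hc, h⟩
    · obtain ⟨j, hj⟩ := (hmem c.2).1 (Finset.mem_union_right _ (Finset.mem_image_of_mem _ hc))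
      exact ⟨j, Or.inl (by rw [← h, hj]; exact hc)⟩
    · obtain ⟨j, hj⟩ := (hmem c.1).1 (Finset.mem_union_left _ (Finset.mem_image_of_mem _ hc))
      exact ⟨j, Or.inr (by rw [← h, hj]; exact hc)⟩
  choose σ hσ using hex
  have huniq : ∀ i j j', ((e i, e j) ∈ S ∨ (e j, e i) ∈ S) → ((e i, e j') ∈ S ∨ (e j', e i) ∈ S) →
      j = j' := by
    rintro i j j' (h | h) (h' | h')
    · exact e.injective (Prod.ext_iff.1 (hS.fst_inj _ h _ h' rfl)).2
    · exact absurd rfl (hS.fst_ne_snd _ h _ h')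
    · exact absurd rfl (hS.fst_ne_snd _ h' _ h)
    · exact e.injective (Prod.ext_iff.1 (hS.snd_inj _ h _ h' rfl)).1
  have hinv : Function.Involutive σ := fun i => huniq (σ i) _ _ (hσ (σ i)) (hσ i).symm
  refine ⟨⟨hinv.toPerm, hinv, fun i hi => ?_⟩, e, ?_⟩
  · have h := hσ i
    have hi : σ i = i := hi
    rw [hi, or_self] at h
    exact lt_irrefl _ (hS.lt _ h)
  · ext ⟨x, y⟩
    simp only [Finset.mem_map, mem_chords]
    constructor
    · intro h
      obtain ⟨i, rfl⟩ := (hmem x).1 (Finset.mem_union_left _ (Finset.mem_image_of_mem _ h))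
      obtain ⟨j, rfl⟩ := (hmem y).1 (Finset.mem_union_right _ (Finset.mem_image_of_mem _ h))
      exact ⟨(i, j), ⟨e.lt_iff_lt.1 (hS.lt _ h), huniq i _ _ (hσ i) (Or.inl h)⟩, rfl⟩
    · rintro ⟨⟨i, j⟩, ⟨hij, h⟩, hxy⟩
      obtain ⟨rfl, rfl⟩ := Prod.mk.inj hxy
      have h : σ i = j := h
      subst h
      refine (hσ i).resolve_right fun h => lt_asymm (e.lt_iff_lt.2 hij) (hS.lt _ h)

/-- Renumber both halves of a root share decomposition to diagrams; `eq_join_of_interlace` forces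
the two embeddings to be `joinLeft` and `joinRight`. -/
theorem exists_eq_join {N : ℕ} {C : ChordDiagram N} (hC : Conn C.chords) (hN : 2 ≤ N) :
    ∃ p q, ∃ h : N = p + q, ∃ (C' : ChordDiagram p) (C'' : ChordDiagram q) (k : Fin (2 * q - 1)),
      Conn C'.chords ∧ Conn C''.chords ∧ h ▸ C = C'.join C'' k := by
  obtain ⟨A, B, r, hAB, hrs⟩ := exists_rootShare hC C.proper_chords (by rwa [C.card_chords])
  obtain ⟨p, hp⟩ : ∃ p, B.card = p := ⟨_, rfl⟩
  obtain ⟨q, hq⟩ : ∃ q, A.card = q := ⟨_, rfl⟩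
  have hpq : N = p + q := by
    rw [← C.card_chords, hAB, Finset.card_union_of_disjoint hrs.disjoint, hp, hq, add_comm]
  subst hpq
  obtain ⟨C', e, he⟩ := exists_eq_map_chords (hrs.proper.mono Finset.subset_union_right) hp
  obtain ⟨C'', f, hf⟩ := exists_eq_map_chords (hrs.proper.mono Finset.subset_union_left) hq
  have hC' : Conn C'.chords := by rw [← conn_map_iff e, ← he]; exact hrs.connB
  have hC'' : Conn C''.chords := by rw [← conn_map_iff f, ← hf]; exact hrs.connA
  have hr : r = chordEmb e (root C'.chords hC'.1) := by
    rw [← hrs.root_right_eq]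
    subst he
    exact root_map e C'.proper_chords _ _
  have hend : ∀ i, ∃ d ∈ B, IsEnd (e i) d := fun i => by
    obtain ⟨c, hc, h⟩ := C'.exists_isEnd i
    exact ⟨chordEmb e c, he ▸ Finset.mem_map_of_mem _ hc, h.imp (congrArg e) (congrArg e)⟩
  have hend' : ∀ j, ∃ d ∈ A, IsEnd (f j) d := fun i => by
    obtain ⟨c, hc, h⟩ := C''.exists_isEnd i
    exact ⟨chordEmb f c, hf ▸ Finset.mem_map_of_mem _ hc, h.imp (congrArg f) (congrArg f)⟩
  have hroot : ∀ i : Fin (2 * p), i.1 = 0 ↔ e i = r.1 := fun i => by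
    rw [hr, chordEmb_fst, e.injective.eq_iff, Fin.ext_iff, C'.root_fst]
  obtain ⟨k, rfl, rfl⟩ := eq_join_of_interlace (e := e) (f := f) (y := r.2)
    (fun i hi j => by
      obtain ⟨d, hd, h⟩ := hend' j
      have h1 := hrs.lt_of_mem_left hd
      have h2 := hrs.proper.lt d (Finset.mem_union_left _ hd)
      rw [(hroot i).1 hi]
      rcases h with h | h <;> rw [h]
      exacts [h1, h1.trans h2])
    (fun i hi j => by
      obtain ⟨d, hd, h⟩ := hend i
      obtain ⟨c, hc, h'⟩ := hend' j
      exact hrs.side d hd _ h (mt (hroot i).2 hi) c hc _ h')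
    (pos_of_conn hC')
    (by
      obtain ⟨c, hc, h⟩ := hrs.below
      rw [hf, Finset.mem_map] at hc
      obtain ⟨c, hc, rfl⟩ := hc
      exact ⟨c.1, h⟩)
    (by
      obtain ⟨c, hc, h⟩ := hrs.above
      rw [hf, Finset.mem_map] at hc
      obtain ⟨c, hc, rfl⟩ := hc
      exact ⟨c.2, h⟩)
  refine ⟨p, q, rfl, C', C'', k, hC', hC'', ext_chords ?_⟩
  rw [chords_join, ← he, ← hf, hAB]

theorem join_injective {C' D' : ChordDiagram p} {C'' D'' : ChordDiagram q} {k : Fin (2 * q - 1)}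
    (h : C'.join C'' k = D'.join D'' k) : C' = D' ∧ C'' = D'' := by
  constructor
  · have : C'.perm = D'.perm := by
      ext1 x
      refine (joinLeft p q k).injective ?_
      rw [← join_perm_left C' C'', h, join_perm_left]
    cases C'; cases D'; cases this; rfl
  · have : C''.perm = D''.perm := by
      ext1 x
      refine (joinRight p q k).injective ?_
      rw [← join_perm_right C' C'', h, join_perm_right]
    cases C''; cases D''; cases this; rfl

end ChordDiagram

/-! ### Branch-left numbers under insertion into a tree. -/

namespace LeafTree

variable {β : Type*}

/-- The leaf labels from left to right. -/
def leaves : LeafTree β → List β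
  | leaf b => [b]
  | node l r => l.leaves ++ r.leaves

/-- The label of the rightmost leaf. -/
def rightmost : LeafTree β → β
  | leaf b => b
  | node _ r => r.rightmost

/-- The leaf whose path up and to the left ends with edge `k + 1`, or contains it. -/
def hit : LeafTree β → ℕ → β
  | leaf b, _ => b
  | node _ r, 0 => r.rightmost
  | node l r, k + 1 => if k < l.numVertices then l.hit k else r.hit (k - l.numVertices)

theorem hasLeaf_iff {b : β} {T : LeafTree β} : T.HasLeaf b ↔ b ∈ T.leaves := by
  induction T with
  | leaf b' => simp [HasLeaf, leaves, eq_comm]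
  | node l r hl hr => simp [HasLeaf, leaves, hl, hr]

theorem leaves_map {γ : Type*} (f : β → γ) (T : LeafTree β) :
    (T.map f).leaves = T.leaves.map f := by
  induction T with
  | leaf b' => rfl
  | node l r hl hr => simp [map, leaves, hl, hr]

theorem rightmost_map {γ : Type*} (f : β → γ) (T : LeafTree β) :
    (T.map f).rightmost = f T.rightmost := by
  induction T with
  | leaf b' => rfl
  | node l r _ hr => exact hr

theorem hit_map {γ : Type*} (f : β → γ) (T : LeafTree β) (k : ℕ) :
    (T.map f).hit k = f (T.hit k) := by
  induction T generalizing k with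
  | leaf b' => rfl
  | node l r hl hr =>
    cases k with
    | zero => exact rightmost_map f r
    | succ k =>
      simp only [map, hit, numVertices_map, hl, hr]
      split_ifs <;> rfl

theorem rightmost_mem (T : LeafTree β) : T.rightmost ∈ T.leaves := by
  induction T with
  | leaf b => simp [rightmost, leaves]
  | node l r _ hr => exact List.mem_append_right _ hr

theorem hit_mem (T : LeafTree β) (k : ℕ) : T.hit k ∈ T.leaves := by
  induction T generalizing k with
  | leaf b => simp [hit, leaves]
  | node l r hl hr =>
    cases k with
    | zero => exact List.mem_append_right _ r.rightmost_mem
    | succ k =>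
      simp only [hit]
      split_ifs
      · exact List.mem_append_left _ (hl _)
      · exact List.mem_append_right _ (hr _)

theorem branchLeftAux_node_of_mem {c : β} {l : LeafTree β} (h : c ∈ l.leaves) (r : LeafTree β)
    (m : ℕ) : branchLeftAux c m (node l r) = l.branchLeft c := by
  rw [branchLeftAux, if_pos (hasLeaf_iff.2 h)]
  rfl

theorem branchLeftAux_node_of_notMem {c : β} {l : LeafTree β} (h : c ∉ l.leaves) (r : LeafTree β)
    (m : ℕ) : branchLeftAux c m (node l r) = branchLeftAux c (m + 1) r := by
  rw [branchLeftAux, if_neg (mt hasLeaf_iff.1 h)]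

theorem insertAt_zero (T T' : LeafTree β) (hk : 0 < T'.numVertices) :
    insertAt T (0 + 1) T' = node T T' := by
  cases T' <;> simp [insertAt]

theorem insertAt_node_left (T : LeafTree β) {k : ℕ} {l : LeafTree β} (r : LeafTree β)
    (hk : k < l.numVertices) :
    insertAt T (k + 1 + 1) (node l r) = node (insertAt T (k + 1) l) r := by
  rw [insertAt, if_neg (by omega), if_pos (by omega), Nat.add_sub_cancel]

theorem insertAt_node_right (T : LeafTree β) {k : ℕ} {l : LeafTree β} (r : LeafTree β)
    (hk : ¬ k < l.numVertices) :
    insertAt T (k + 1 + 1) (node l r) = node l (insertAt T (k - l.numVertices + 1) r) := by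
  rw [insertAt, if_neg (by omega), if_neg (by omega),
    show k + 1 + 1 - 1 - l.numVertices = (k - l.numVertices) + 1 by omega]

theorem numVertices_insertAt (T : LeafTree β) (k : ℕ) (T' : LeafTree β)
    (hk : k < T'.numVertices) :
    (insertAt T (k + 1) T').numVertices = T.numVertices + T'.numVertices + 1 := by
  induction T' generalizing k with
  | leaf b =>
    obtain rfl : k = 0 := Nat.lt_one_iff.1 hk
    rw [insertAt_zero T _ hk]
    change 1 + T.numVertices + 1 = T.numVertices + 1 + 1
    omega
  | node l r hl hr =>
    cases k with
    | zero =>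
      rw [insertAt_zero T _ hk, numVertices]
      omega
    | succ k =>
      simp only [numVertices] at hk
      by_cases h : k < l.numVertices
      · rw [insertAt_node_left T r h, numVertices, numVertices, hl k h]
        omega
      · rw [insertAt_node_right T r h, numVertices, numVertices, hr _ (by omega)]
        omega

theorem leaves_insertAt (T : LeafTree β) (k : ℕ) (T' : LeafTree β) (hk : k < T'.numVertices) :
    (insertAt T (k + 1) T').leaves.Perm (T.leaves ++ T'.leaves) := by
  induction T' generalizing k with
  | leaf b =>
    obtain rfl : k = 0 := Nat.lt_one_iff.1 hk
    rw [insertAt_zero T _ hk]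
    exact .rfl
  | node l r hl hr =>
    cases k with
    | zero => rw [insertAt_zero T _ hk, leaves]
    | succ k =>
      simp only [numVertices] at hk
      by_cases h : k < l.numVertices
      · rw [insertAt_node_left T r h, leaves, leaves, ← List.append_assoc]
        exact (hl k h).append_right _
      · rw [insertAt_node_right T r h, leaves, leaves]
        refine ((hr _ (by omega)).append_left _).trans ?_
        rw [← List.append_assoc, ← List.append_assoc]
        exact List.perm_append_comm.append_right _

/-- Only the rightmost leaf is reached from the root by right steps alone, so only its path
continues above the root. -/
theorem branchLeftAux_eq [DecidableEq β] {c : β} {T : LeafTree β} (hT : T.leaves.Nodup)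
    (hc : c ∈ T.leaves) (m : ℕ) :
    branchLeftAux c m T = T.branchLeft c + if T.rightmost = c then m else 0 := by
  induction T generalizing m with
  | leaf b =>
    rw [leaves, List.mem_singleton] at hc
    simp [branchLeftAux, branchLeft, rightmost, hc]
  | node l r _ hr =>
    simp only [leaves, List.nodup_append, List.mem_append] at hT hc
    by_cases hl : c ∈ l.leaves
    · rw [branchLeft, branchLeftAux_node_of_mem hl, branchLeftAux_node_of_mem hl, rightmost,
        if_neg fun h : r.rightmost = c => hT.2.2 c hl c (h ▸ r.rightmost_mem) rfl, add_zero]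
    · have hcr := hc.resolve_left hl
      rw [branchLeft, branchLeftAux_node_of_notMem hl, branchLeftAux_node_of_notMem hl,
        hr hT.2.1 hcr, hr hT.2.1 hcr, rightmost]
      split_ifs <;> omega

/-- `T` becomes a left subtree, so paths from its leaves stop at its root at the latest. -/
theorem branchLeftAux_insertAt_left {c : β} {T T' : LeafTree β} {k : ℕ}
    (hd : (T.leaves ++ T'.leaves).Nodup) (hc : c ∈ T.leaves) (hk : k < T'.numVertices) (m : ℕ) :
    branchLeftAux c m (insertAt T (k + 1) T') = T.branchLeft c := by
  induction T' generalizing k m with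
  | leaf b =>
    obtain rfl : k = 0 := Nat.lt_one_iff.1 hk
    rw [insertAt_zero T _ hk, branchLeftAux_node_of_mem hc]
  | node l r hl hr =>
    simp only [leaves, List.nodup_append, List.mem_append] at hd
    cases k with
    | zero => rw [insertAt_zero T _ hk, branchLeftAux_node_of_mem hc]
    | succ k =>
      simp only [numVertices] at hk
      by_cases h : k < l.numVertices
      · rw [insertAt_node_left T r h, branchLeftAux_node_of_mem
          ((leaves_insertAt T k l h).mem_iff.2 (List.mem_append_left _ hc))]
        refine hl (List.nodup_append.2 ⟨hd.1, hd.2.1.1, fun a ha b hb => ?_⟩) h 0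
        exact hd.2.2 a ha b (Or.inl hb)
      · rw [insertAt_node_right T r h,
          branchLeftAux_node_of_notMem fun h => hd.2.2 c hc c (Or.inl h) rfl]
        refine hr (List.nodup_append.2 ⟨hd.1, hd.2.1.2.1, fun a ha b hb => ?_⟩) (by omega) _
        exact hd.2.2 a ha b (Or.inr hb)

/-- The part below edge `k + 1` becomes a right subtree of the new vertex. Exactly its rightmost
leaf, which is `T'.hit k`, gains an edge on its path. -/
theorem branchLeftAux_insertAt_right [DecidableEq β] {c : β} {T T' : LeafTree β} {k : ℕ}
    (hd : (T.leaves ++ T'.leaves).Nodup) (hc : c ∈ T'.leaves) (hk : k < T'.numVertices) (m : ℕ) :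
    branchLeftAux c m (insertAt T (k + 1) T') =
      branchLeftAux c m T' + if T'.hit k = c then 1 else 0 := by
  have hcT : c ∉ T.leaves := fun h => (List.nodup_append.1 hd).2.2 c h c hc rfl
  induction T' generalizing k m with
  | leaf b =>
    obtain rfl : k = 0 := Nat.lt_one_iff.1 hk
    rw [leaves, List.mem_singleton] at hc
    rw [insertAt_zero T _ hk, branchLeftAux_node_of_notMem hcT, hit, if_pos hc.symm]
    rfl
  | node l r hl hr =>
    have hN : (node l r).leaves.Nodup := (List.nodup_append.1 hd).2.1
    have hcN := hc
    simp only [leaves, List.nodup_append, List.mem_append] at hd hc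
    cases k with
    | zero =>
      rw [insertAt_zero T _ hk, branchLeftAux_node_of_notMem hcT, branchLeftAux_eq hN hcN,
        branchLeftAux_eq hN hcN m, hit, rightmost]
      split_ifs <;> omega
    | succ k =>
      simp only [numVertices] at hk
      rw [hit]
      by_cases hkl : k < l.numVertices
      · have hins : c ∈ (insertAt T (k + 1) l).leaves ↔ c ∈ l.leaves := by
          rw [(leaves_insertAt T k l hkl).mem_iff, List.mem_append]
          exact or_iff_right hcT
        rw [if_pos hkl, insertAt_node_left T r hkl]
        by_cases h : c ∈ l.leaves
        · rw [branchLeftAux_node_of_mem h, branchLeftAux_node_of_mem (hins.2 h)]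
          refine hl (List.nodup_append.2 ⟨hd.1, hd.2.1.1, fun a ha b hb => ?_⟩) h hkl 0
          exact hd.2.2 a ha b (Or.inl hb)
        · have hne : l.hit k ≠ c := fun e => h (e ▸ hit_mem l k)
          rw [branchLeftAux_node_of_notMem h, branchLeftAux_node_of_notMem (mt hins.1 h),
            if_neg hne, add_zero]
      · rw [if_neg hkl, insertAt_node_right T r hkl]
        by_cases h : c ∈ l.leaves
        · have hne : r.hit (k - l.numVertices) ≠ c := fun e =>
            hd.2.1.2.2 c h c (e ▸ hit_mem r _) rfl
          rw [branchLeftAux_node_of_mem h, branchLeftAux_node_of_mem h, if_neg hne, add_zero]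
        · rw [branchLeftAux_node_of_notMem h, branchLeftAux_node_of_notMem h]
          refine hr (List.nodup_append.2 ⟨hd.1, hd.2.1.2.1, fun a ha b hb => ?_⟩)
            (hc.resolve_left h) (by omega) _
          exact hd.2.2 a ha b (Or.inr hb)

/-- The leaf `c` is hit by the edges above those vertices whose subtree has `c` as its rightmost
leaf. These are the vertices on its path, one more than the path has edges. -/
theorem sum_hit_eq [DecidableEq β] {c : β} {T : LeafTree β} (hT : T.leaves.Nodup)
    (hc : c ∈ T.leaves) :
    ∑ k ∈ Finset.range T.numVertices, (if T.hit k = c then 1 else 0) = T.branchLeft c + 1 := by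
  have hzero : ∀ T : LeafTree β, c ∉ T.leaves →
      ∑ k ∈ Finset.range T.numVertices, (if T.hit k = c then 1 else 0) = 0 := fun T h =>
    Finset.sum_eq_zero fun k _ => if_neg fun e : T.hit k = c => h (e ▸ hit_mem T k)
  induction T with
  | leaf b =>
    rw [leaves, List.mem_singleton] at hc
    simp [numVertices, hit, hc, branchLeft, branchLeftAux]
  | node l r hl hr =>
    simp only [leaves, List.nodup_append, List.mem_append] at hT hc
    rw [numVertices, show 1 + l.numVertices + r.numVertices =
      (l.numVertices + r.numVertices) + 1 by omega, Finset.sum_range_succ',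
      Finset.sum_range_add]
    have h1 : ∀ k ∈ Finset.range l.numVertices,
        (if (node l r).hit (k + 1) = c then 1 else 0) = if l.hit k = c then 1 else 0 := by
      intro k hk
      rw [hit, if_pos (Finset.mem_range.1 hk)]
    have h2 : ∀ k ∈ Finset.range r.numVertices,
        (if (node l r).hit (l.numVertices + k + 1) = c then 1 else 0) =
          if r.hit k = c then 1 else 0 := by
      intro k hk
      rw [hit, if_neg (Nat.not_lt.2 (Nat.le_add_right _ _)), Nat.add_sub_cancel_left]
    rw [Finset.sum_congr rfl h1, Finset.sum_congr rfl h2, hit, branchLeft]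
    by_cases h : c ∈ l.leaves
    · have hcr : c ∉ r.leaves := fun h' => hT.2.2 c h c h' rfl
      have hne : r.rightmost ≠ c := fun e => hcr (e ▸ rightmost_mem r)
      rw [hl hT.1 h, hzero r hcr, if_neg hne, branchLeftAux_node_of_mem h]
    · have hcr := hc.resolve_left h
      rw [hr hT.2.1 hcr, hzero l h, branchLeftAux_node_of_notMem h, branchLeftAux_eq hT.2.1 hcr]
      split_ifs <;> omega

end LeafTree

/-! ### The insertion tree of a composed diagram. -/

namespace ChordDiagram

variable {p q : ℕ}

theorem insertionTree_join {C' : ChordDiagram p} {C'' : ChordDiagram q} (hC' : Conn C'.chords)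
    (hC'' : Conn C''.chords) (k : Fin (2 * q - 1)) (h : (C'.join C'' k).chords.Nonempty) :
    insertionTree (C'.join C'' k).chords h =
      LeafTree.insertAt ((insertionTree C'.chords hC'.1).map (chordEmb (joinLeft p q k)))
        (k + 1) ((insertionTree C''.chords hC''.1).map (chordEmb (joinRight p q k))) := by
  have hrs := rootShare_join hC' hC'' k
  have := hrs.insertionTree_union
  rw [chordEmb_snd, numEndpointsBelow_joinRight, insertionTree_map _ C'.proper_chords hC'.1,
    insertionTree_map _ C''.proper_chords hC''.1] at this
  rw [← this]
  simp only [chords_join]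

theorem chords_eq_singleton {C : ChordDiagram 1} (h : C.chords.Nonempty) :
    C.chords = {root C.chords h} := by
  obtain ⟨c, hc⟩ := Finset.card_eq_one.1 C.card_chords
  have hr := root_mem _ h
  generalize root C.chords h = r at *
  rw [hc, Finset.mem_singleton] at hr
  rw [hc, hr]

theorem insertionTree_size_one {C : ChordDiagram 1} (h : C.chords.Nonempty) :
    insertionTree C.chords h = LeafTree.leaf (root C.chords h) := by
  refine insertionTree_of_card_eq_one h ?_
  rw [← Finset.card_pos, Finset.card_erase_of_mem (root_mem _ h), C.card_chords]
  simp

/-- The vertex count shows that the gaps `Fin (2 * n - 1)` of a diagram correspond exactly to the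
edges of its tree. -/
theorem insertionTree_spec {n : ℕ} {C : ChordDiagram n} (hC : Conn C.chords) :
    (insertionTree C.chords hC.1).numVertices = 2 * n - 1 ∧
      (insertionTree C.chords hC.1).leaves.Nodup ∧
      ∀ c, c ∈ (insertionTree C.chords hC.1).leaves ↔ c ∈ C.chords := by
  induction n using Nat.strong_induction_on with
  | _ n ih =>
    have hn := pos_of_conn hC
    rcases Nat.lt_or_ge 1 n with h2 | h1
    · obtain ⟨p, q, rfl, C', C'', k, hC', hC'', hJ⟩ := exists_eq_join hC h2
      have hJ : C = C'.join C'' k := hJ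
      subst hJ
      have hp := pos_of_conn hC'
      have hq := pos_of_conn hC''
      obtain ⟨a1, a2, a3⟩ := ih p (by omega) hC'
      obtain ⟨b1, b2, b3⟩ := ih q (by omega) hC''
      have hk : k.1 < ((insertionTree C''.chords hC''.1).map
          (chordEmb (joinRight p q k))).numVertices := by
        rw [LeafTree.numVertices_map, b1]; exact k.2
      have hperm := LeafTree.leaves_insertAt
        ((insertionTree C'.chords hC'.1).map (chordEmb (joinLeft p q k))) k _ hk
      rw [LeafTree.leaves_map, LeafTree.leaves_map] at hperm
      rw [insertionTree_join hC' hC'', LeafTree.numVertices_insertAt _ _ _ hk,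
        LeafTree.numVertices_map, LeafTree.numVertices_map, a1, b1, hperm.nodup_iff]
      refine ⟨by omega, ?_, fun c => ?_⟩
      · refine List.nodup_append.2 ⟨a2.map (chordEmb _).injective, b2.map (chordEmb _).injective,
          ?_⟩
        simp only [List.mem_map]
        rintro _ ⟨x, -, rfl⟩ _ ⟨y, -, rfl⟩ h
        exact joinLeft_ne_joinRight _ _ (congrArg Prod.fst h)
      · rw [hperm.mem_iff, chords_join]
        simp only [List.mem_append, List.mem_map, Finset.mem_union, Finset.mem_map, a3, b3]
        exact or_comm
    · obtain rfl : n = 1 := by omega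
      rw [insertionTree_size_one]
      refine ⟨rfl, List.nodup_singleton _, fun c => ?_⟩
      conv_rhs => rw [chords_eq_singleton hC.1]
      simp [LeafTree.leaves]

end ChordDiagram

theorem idxOf_map_of_injective {α β : Type*} [BEq α] [LawfulBEq α] [BEq β] [LawfulBEq β]
    {f : α → β} (hf : Function.Injective f) (l : List α) (a : α) :
    (l.map f).idxOf (f a) = l.idxOf a := by
  induction l with
  | nil => rfl
  | cons b l ih =>
    by_cases h : b = a
    · subst h; simp
    · rw [List.map_cons, List.idxOf_cons_ne _ h, List.idxOf_cons_ne _ (hf.ne h), ih]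

namespace ChordDiagram

variable {p q : ℕ}

/-- The chords of `C' ∘ₖ₊₁ C''` are those of `C'` and those of `C''`. -/
def joinChordEquiv (C' : ChordDiagram p) (C'' : ChordDiagram q) (k : Fin (2 * q - 1)) :
    {c // c ∈ C'.chords} ⊕ {c // c ∈ C''.chords} ≃ {c // c ∈ (C'.join C'' k).chords} :=
  Equiv.ofBijective
    (Sum.elim
      (fun c => ⟨chordEmb (joinLeft p q k) c.1, by
        rw [chords_join]
        exact Finset.mem_union_right _ (Finset.mem_map_of_mem _ c.2)⟩)
      (fun c => ⟨chordEmb (joinRight p q k) c.1, by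
        rw [chords_join]
        exact Finset.mem_union_left _ (Finset.mem_map_of_mem _ c.2)⟩))
    (by
      constructor
      · refine Function.Injective.sumElim (fun x y h => ?_) (fun x y h => ?_) (fun x y h => ?_)
        · exact Subtype.ext ((chordEmb _).injective (Subtype.ext_iff.1 h))
        · exact Subtype.ext ((chordEmb _).injective (Subtype.ext_iff.1 h))
        · exact joinLeft_ne_joinRight _ _ (congrArg Prod.fst (Subtype.ext_iff.1 h))
      · rintro ⟨c, hc⟩
        have hc' := hc
        rw [chords_join, Finset.mem_union, Finset.mem_map, Finset.mem_map] at hc'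
        rcases hc' with ⟨d, hd, rfl⟩ | ⟨d, hd, rfl⟩
        · exact ⟨Sum.inr ⟨d, hd⟩, rfl⟩
        · exact ⟨Sum.inl ⟨d, hd⟩, rfl⟩)

end ChordDiagram

/-! ### Labels, terminal chords and base chords under composition. -/

namespace DecDiagram

variable {D : Set ℕ+}

theorem conn (C : DecDiagram D) : Conn C.diagram.chords := connected_iff_conn.1 C.connected

theorem size_pos (C : DecDiagram D) : 0 < C.size := ChordDiagram.pos_of_conn C.conn

theorem mem_terminal {C : DecDiagram D} {c : C.Chord} :
    c ∈ C.terminal ↔ ∀ c' : C.Chord, c.1.1 < c'.1.1 → ¬ Crosses c.1 c'.1 := by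
  simp [terminal]

theorem label_pos (C : DecDiagram D) (c : C.Chord) : 0 < C.label c := Nat.succ_pos _

theorem label_le (C : DecDiagram D) (c : C.Chord) : C.label c ≤ C.size := by
  have h := List.idxOf_lt_length_iff.2 (mem_intersectionOrder.2 c.2)
  rwa [length_intersectionOrder, C.diagram.card_chords] at h

theorem label_injective (C : DecDiagram D) : Function.Injective C.label := by
  intro c d h
  have hc : c.1 ∈ intersectionOrder C.diagram.chords := mem_intersectionOrder.2 c.2
  exact Subtype.ext ((List.idxOf_inj hc).1 (Nat.succ_injective h))

/-- The root chord. -/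
def rootChord (C : DecDiagram D) : C.Chord :=
  ⟨root C.diagram.chords C.chords_nonempty, root_mem _ _⟩

theorem label_rootChord (C : DecDiagram D) : C.label C.rootChord = 1 := by
  rw [label, C.conn.intersectionOrder_eq]
  simp [rootChord]

theorem rootChord_lt {C : DecDiagram D} {c : C.Chord} (hc : c ≠ C.rootChord) :
    C.rootChord.1.1 < c.1.1 :=
  (root_fst_le C.chords_nonempty c.2).lt_of_ne fun e => hc
    (Subtype.ext (C.diagram.proper_chords.fst_inj _ c.2 _ C.rootChord.2 e.symm))

/-- All other chords begin after the root, so a terminal root crosses nothing and is a component by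
itself. -/
theorem eq_rootChord_of_terminal {C : DecDiagram D} (h : C.rootChord ∈ C.terminal)
    (c : C.Chord) : c = C.rootChord := by
  rw [mem_terminal] at h
  have hcl : IsClosedIn {C.rootChord.1} C.diagram.chords := by
    refine ⟨Finset.singleton_subset_iff.2 C.rootChord.2, fun x hx y hy hxy => ?_⟩
    rw [Finset.mem_singleton] at hx ⊢
    subst hx
    by_contra hne
    exact h ⟨y, hy⟩ (rootChord_lt (c := ⟨y, hy⟩) fun e => hne (Subtype.ext_iff.1 e)) hxy
  have := C.conn.2 _ hcl (Finset.singleton_nonempty _)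
  obtain ⟨c, hc⟩ := c
  rw [← this, Finset.mem_singleton] at hc
  exact Subtype.ext hc

theorem baseChord_mem (C : DecDiagram D) : C.baseChord ∈ C.terminal :=
  (C.terminal.exists_min_image C.label C.terminal_nonempty).choose_spec.1

theorem b_le {C : DecDiagram D} {c : C.Chord} (hc : c ∈ C.terminal) : C.b ≤ C.label c :=
  (C.terminal.exists_min_image C.label C.terminal_nonempty).choose_spec.2 c hc

theorem b_lt {C : DecDiagram D} {c : C.Chord} (hc : c ∈ C.terminal) (h : c ≠ C.baseChord) :
    C.b < C.label c :=
  (b_le hc).lt_of_ne fun e => h (C.label_injective e.symm)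

theorem baseChord_eq {C : DecDiagram D} {c : C.Chord} (hc : c ∈ C.terminal)
    (h : ∀ c' ∈ C.terminal, C.label c ≤ C.label c') : C.baseChord = c :=
  C.label_injective ((b_le hc).antisymm (h _ C.baseChord_mem))

theorem prevTerminal_eq {C : DecDiagram D} {c c' : C.Chord} (hc' : c' ∈ C.terminal)
    (hlt : C.label c' < C.label c)
    (h : ∀ d ∈ C.terminal, C.label d < C.label c → C.label d ≤ C.label c') :
    C.prevTerminal c = C.label c' := by
  refine le_antisymm (Finset.sup_le fun d hd => ?_)
    (Finset.le_sup (f := C.label) (Finset.mem_filter.2 ⟨hc', hlt⟩))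
  rw [Finset.mem_filter] at hd
  exact h d hd.1 hd.2

theorem exists_prevTerminal {C : DecDiagram D} {c : C.Chord} (hc : c ∈ C.terminal)
    (hb : c ≠ C.baseChord) : ∃ c' ∈ C.terminal, C.label c' < C.label c ∧
      (∀ d ∈ C.terminal, C.label d < C.label c → C.label d ≤ C.label c') ∧
      C.prevTerminal c = C.label c' := by
  obtain ⟨c', hc', hmax⟩ := Finset.exists_max_image
    (C.terminal.filter fun c' => C.label c' < C.label c) C.label
    ⟨C.baseChord, Finset.mem_filter.2 ⟨C.baseChord_mem, b_lt hc hb⟩⟩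
  rw [Finset.mem_filter] at hc'
  have h : ∀ d ∈ C.terminal, C.label d < C.label c → C.label d ≤ C.label c' :=
    fun d hd hlt => hmax d (Finset.mem_filter.2 ⟨hd, hlt⟩)
  exact ⟨c', hc'.1, hc'.2, h, prevTerminal_eq hc'.1 hc'.2 h⟩

/-- The root share composition `C' ∘ₖ₊₁ C''`. -/
def join (C' C'' : DecDiagram D) (k : Fin (2 * C''.size - 1)) : DecDiagram D where
  size := C'.size + C''.size
  diagram := C'.diagram.join C''.diagram k
  connected := connected_iff_conn.2 (ChordDiagram.conn_join C'.conn C''.conn k)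
  dec := Sum.elim C'.dec C''.dec ∘ (C'.diagram.joinChordEquiv C''.diagram k).symm
  dec_mem c := by
    dsimp only [Function.comp]
    rcases (C'.diagram.joinChordEquiv C''.diagram k).symm c with x | x
    exacts [C'.dec_mem x, C''.dec_mem x]

section Join

variable {C' C'' : DecDiagram D} {k : Fin (2 * C''.size - 1)}

/-- The positions of the end points of `C'` in `C' ∘ₖ₊₁ C''`. -/
def embLeft (C' C'' : DecDiagram D) (k : Fin (2 * C''.size - 1)) :
    Fin (2 * C'.size) ↪o Fin (2 * (C'.join C'' k).size) :=
  joinLeft C'.size C''.size k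

/-- The positions of the end points of `C''` in `C' ∘ₖ₊₁ C''`. -/
def embRight (C' C'' : DecDiagram D) (k : Fin (2 * C''.size - 1)) :
    Fin (2 * C''.size) ↪o Fin (2 * (C'.join C'' k).size) :=
  joinRight C'.size C''.size k

theorem chords_join : (C'.join C'' k).diagram.chords =
    C''.diagram.chords.map (chordEmb (embRight C' C'' k)) ∪
      C'.diagram.chords.map (chordEmb (embLeft C' C'' k)) :=
  ChordDiagram.chords_join ..

/-- The chords of `C' ∘ₖ₊₁ C''` that come from `C'`. -/
def inl (k : Fin (2 * C''.size - 1)) (c : C'.Chord) : (C'.join C'' k).Chord :=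
  C'.diagram.joinChordEquiv C''.diagram k (Sum.inl c)

/-- The chords of `C' ∘ₖ₊₁ C''` that come from `C''`. -/
def inr (k : Fin (2 * C''.size - 1)) (c : C''.Chord) : (C'.join C'' k).Chord :=
  C'.diagram.joinChordEquiv C''.diagram k (Sum.inr c)

theorem inl_val (c : C'.Chord) :
    (inl k c).1 = chordEmb (embLeft C' C'' k) c.1 := rfl

theorem inr_val (c : C''.Chord) :
    (inr (C' := C') k c).1 = chordEmb (embRight C' C'' k) c.1 := rfl

theorem dec_inl (c : C'.Chord) : (C'.join C'' k).dec (inl k c) = C'.dec c := by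
  simp [join, inl]

theorem dec_inr (c : C''.Chord) : (C'.join C'' k).dec (inr k c) = C''.dec c := by
  simp [join, inr]

theorem inl_injective : Function.Injective (inl (C' := C') k) :=
  (Equiv.injective _).comp Sum.inl_injective

theorem inr_injective : Function.Injective (inr (C' := C') k) :=
  (Equiv.injective _).comp Sum.inr_injective

theorem inl_ne_inr (c : C'.Chord) (d : C''.Chord) : inl k c ≠ inr k d :=
  (Equiv.injective _).ne Sum.inl_ne_inr

theorem forall_join {P : (C'.join C'' k).Chord → Prop} :
    (∀ c, P c) ↔ (∀ c, P (inl k c)) ∧ ∀ c, P (inr k c) := by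
  refine ⟨fun h => ⟨fun c => h _, fun c => h _⟩, fun h c => ?_⟩
  obtain ⟨x, rfl⟩ := (C'.diagram.joinChordEquiv C''.diagram k).surjective c
  rcases x with x | x
  exacts [h.1 x, h.2 x]

theorem prod_join {M : Type*} [CommMonoid M] (f : (C'.join C'' k).Chord → M) :
    ∏ c, f c = (∏ c, f (inl k c)) * ∏ c, f (inr k c) := by
  have := (C'.diagram.joinChordEquiv C''.diagram k).prod_comp f
  rw [Fintype.prod_sum_type] at this
  exact this.symm

theorem sum_join {M : Type*} [AddCommMonoid M] (f : (C'.join C'' k).Chord → M) :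
    ∑ c, f c = (∑ c, f (inl k c)) + ∑ c, f (inr k c) := by
  have := (C'.diagram.joinChordEquiv C''.diagram k).sum_comp f
  rw [Fintype.sum_sum_type] at this
  exact this.symm

theorem norm_join : (C'.join C'' k).norm = C'.norm + C''.norm := by
  rw [norm, sum_join, norm, norm]
  simp only [dec_inl, dec_inr]

theorem rootShare : RootShare
    (C''.diagram.chords.map (chordEmb (embRight C' C'' k)))
    (C'.diagram.chords.map (chordEmb (embLeft C' C'' k)))
    (inl k C'.rootChord).1 :=
  ChordDiagram.rootShare_join C'.conn C''.conn k

theorem intersectionOrder_join : intersectionOrder (C'.join C'' k).diagram.chords =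
    (inl k C'.rootChord).1 :: ((intersectionOrder C''.diagram.chords).map
      (chordEmb (embRight C' C'' k)) ++ intersectionOrder
        ((C'.diagram.chords.map (chordEmb (embLeft C' C'' k))).erase
          (inl k C'.rootChord).1)) := by
  rw [← intersectionOrder_map _ C''.diagram.proper_chords, ← rootShare.intersectionOrder_union,
    chords_join]

theorem inl_val_mem (c : C'.Chord) :
    (inl k c).1 ∈ C'.diagram.chords.map (chordEmb (embLeft C' C'' k)) :=
  Finset.mem_map_of_mem _ c.2

theorem inr_val_mem (c : C''.Chord) : (inr (C' := C') k c).1 ∈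
    C''.diagram.chords.map (chordEmb (embRight C' C'' k)) :=
  Finset.mem_map_of_mem _ c.2

theorem label_inl_rootChord : (C'.join C'' k).label (inl k C'.rootChord) = 1 := by
  rw [label, intersectionOrder_join]
  simp

theorem label_inr (c : C''.Chord) : (C'.join C'' k).label (inr k c) = C''.label c + 1 := by
  have hmem : (inr (C' := C') k c).1 ∈ (intersectionOrder C''.diagram.chords).map
      (chordEmb (embRight C' C'' k)) :=
    List.mem_map_of_mem (mem_intersectionOrder.2 c.2)
  have hne : (inl k C'.rootChord).1 ≠ (inr (C' := C') k c).1 := fun h =>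
    inl_ne_inr _ _ (Subtype.ext h)
  rw [label, intersectionOrder_join, List.idxOf_cons_ne _ hne, List.idxOf_append_of_mem hmem,
    inr_val, idxOf_map_of_injective (chordEmb _).injective]
  rfl

theorem label_inl {c : C'.Chord} (hc : c ≠ C'.rootChord) :
    (C'.join C'' k).label (inl k c) = C'.label c + C''.size := by
  have hmem : (inl k c).1 ∉ (intersectionOrder C''.diagram.chords).map
      (chordEmb (embRight C' C'' k)) := by
    rw [List.mem_map]
    rintro ⟨d, hd, h⟩
    rw [mem_intersectionOrder] at hd
    exact inl_ne_inr c ⟨d, hd⟩ (Subtype.ext h.symm)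
  have hne : (inl k C'.rootChord).1 ≠ (inl k c).1 := fun h =>
    hc (inl_injective (Subtype.ext h)).symm
  have h := (rootShare (C' := C') (C'' := C'') (k := k)).intersectionOrder_right
  rw [intersectionOrder_map _ C'.diagram.proper_chords] at h
  rw [label, intersectionOrder_join, List.idxOf_cons_ne _ hne,
    List.idxOf_append_of_notMem hmem, List.length_map, length_intersectionOrder,
    C''.diagram.card_chords, label,
    ← idxOf_map_of_injective (chordEmb (embLeft C' C'' k)).injective, h,
    ← inl_val, List.idxOf_cons_ne _ hne]
  omega

/-- The only chord of `C'` that can cross a chord of `C''` is the root, and it begins earlier. -/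
theorem mem_terminal_inr {c : C''.Chord} :
    inr k c ∈ (C'.join C'' k).terminal ↔ c ∈ C''.terminal := by
  rw [mem_terminal, mem_terminal, forall_join]
  have hrs := rootShare (C' := C') (C'' := C'') (k := k)
  constructor
  · intro h d hlt hx
    refine h.2 d ?_ ((crosses_chordEmb _).2 hx)
    exact (OrderEmbedding.lt_iff_lt _).2 hlt
  · refine fun h => ⟨fun d hlt => ?_, fun d hlt hx => ?_⟩
    · by_cases hd : d = C'.rootChord
      · subst hd
        exact absurd hlt (hrs.lt_of_mem_left (inr_val_mem c)).asymm
      · exact hrs.not_crosses (inr_val_mem c) (inl_val_mem d)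
          fun e => hd (inl_injective (Subtype.ext e))
    · exact h d ((OrderEmbedding.lt_iff_lt _).1 hlt) ((crosses_chordEmb _).1 hx)

theorem mem_terminal_inl {c : C'.Chord} :
    inl k c ∈ (C'.join C'' k).terminal ↔ c ≠ C'.rootChord ∧ c ∈ C'.terminal := by
  rw [mem_terminal, mem_terminal, forall_join]
  have hrs := rootShare (C' := C') (C'' := C'') (k := k)
  constructor
  · refine fun h => ⟨?_, fun d hlt hx => ?_⟩
    · rintro rfl
      obtain ⟨d, hd, hx⟩ := hrs.exists_crosses_root
      have hlt := hrs.lt_of_mem_left hd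
      rw [Finset.mem_map] at hd
      obtain ⟨d, hd, rfl⟩ := hd
      exact h.2 ⟨d, hd⟩ hlt hx
    · refine h.1 d ?_ ((crosses_chordEmb _).2 hx)
      exact (OrderEmbedding.lt_iff_lt _).2 hlt
  · refine fun h => ⟨fun d hlt hx => ?_, fun d _ hx => ?_⟩
    · exact h.2 d ((OrderEmbedding.lt_iff_lt _).1 hlt) ((crosses_chordEmb _).1 hx)
    · exact hrs.not_crosses (inr_val_mem d) (inl_val_mem c)
          (fun e => h.1 (inl_injective (Subtype.ext e))) hx.symm

/-- All labels of `C''` precede those of the non-root chords of `C'`, and the root is not terminal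
in the composition. -/
theorem baseChord_join : (C'.join C'' k).baseChord = inr k C''.baseChord := by
  refine baseChord_eq (mem_terminal_inr.2 C''.baseChord_mem) ?_
  rw [forall_join]
  refine ⟨fun c hc => ?_, fun c hc => ?_⟩
  · rw [label_inr, label_inl (mem_terminal_inl.1 hc).1]
    have h1 := C''.label_le C''.baseChord
    have h2 := C'.label_pos c
    omega
  · rw [label_inr, label_inr]
    exact Nat.succ_le_succ (b_le (mem_terminal_inr.1 hc))

theorem b_join : (C'.join C'' k).b = C''.b + 1 := by
  rw [b, baseChord_join, label_inr]
  rfl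

theorem prevTerminal_inr {c : C''.Chord} (hc : c ∈ C''.terminal) (hb : c ≠ C''.baseChord) :
    (C'.join C'' k).prevTerminal (inr k c) = C''.prevTerminal c + 1 := by
  obtain ⟨d, hd, hlt, hmax, he⟩ := exists_prevTerminal hc hb
  rw [he, ← label_inr (C' := C') (k := k)]
  refine prevTerminal_eq (mem_terminal_inr.2 hd) (by
    rw [label_inr, label_inr]; omega) ?_
  rw [forall_join]
  refine ⟨fun x hx hxlt => ?_, fun x hx hxlt => ?_⟩
  · rw [label_inr, label_inl (mem_terminal_inl.1 hx).1] at hxlt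
    have h1 := C''.label_le c
    have h2 := C'.label_pos x
    omega
  · rw [label_inr, label_inr] at hxlt ⊢
    exact Nat.succ_le_succ (hmax x (mem_terminal_inr.1 hx) (Nat.lt_of_succ_lt_succ hxlt))

theorem prevTerminal_inl {c : C'.Chord} (hr : c ≠ C'.rootChord) (hc : c ∈ C'.terminal)
    (hb : c ≠ C'.baseChord) :
    (C'.join C'' k).prevTerminal (inl k c) = C'.prevTerminal c + C''.size := by
  have hroot : C'.rootChord ∉ C'.terminal := fun h => hr (eq_rootChord_of_terminal h c)
  obtain ⟨d, hd, hlt, hmax, he⟩ := exists_prevTerminal hc hb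
  have hdr : d ≠ C'.rootChord := fun h => hroot (h ▸ hd)
  rw [he, ← label_inl (C'' := C'') (k := k) hdr]
  refine prevTerminal_eq (mem_terminal_inl.2 ⟨hdr, hd⟩) (by
    rw [label_inl hdr, label_inl hr]; omega) ?_
  rw [forall_join]
  refine ⟨fun x hx hxlt => ?_, fun x hx hxlt => ?_⟩
  · have hx := mem_terminal_inl.1 hx
    rw [label_inl hr, label_inl hx.1] at hxlt
    rw [label_inl hdr, label_inl hx.1]
    have := hmax x hx.2 (by omega)
    omega
  · rw [label_inr, label_inl hdr]
    have h1 := C''.label_le x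
    have h2 := C'.label_pos d
    omega

end Join

theorem ext_of_size_eq_one {C C₁ : DecDiagram D} (h : C.size = 1) (h₁ : C₁.size = 1)
    (hd : C.dec C.baseChord = C₁.dec C₁.baseChord) : C = C₁ := by
  obtain ⟨n, d, hc, f, hf⟩ := C
  obtain ⟨n₁, d₁, hc₁, f₁, hf₁⟩ := C₁
  dsimp only at h h₁
  subst h h₁
  have key : ∀ d : ChordDiagram 1, ∀ h : d.chords.Nonempty, root d.chords h = (0, 1) := by
    intro d h
    have h1 := (ChordDiagram.mem_chords.1 (root_mem _ h)).1
    generalize root d.chords h = c at h1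
    obtain ⟨x, y⟩ := c
    have hx := x.2
    have hy := y.2
    rw [Fin.lt_def] at h1
    dsimp only at h1
    refine Prod.ext (Fin.ext ?_) (Fin.ext ?_)
    · change x.1 = 0; omega
    · change y.1 = 1; omega
  have hdd : d = d₁ := ChordDiagram.ext_chords (by
    rw [ChordDiagram.chords_eq_singleton (connected_iff_conn.1 hc).1,
      ChordDiagram.chords_eq_singleton (connected_iff_conn.1 hc₁).1, key, key])
  subst hdd
  have hsub : ∀ x y : {c // c ∈ d.chords}, x = y := by
    intro x y
    have := Finset.card_le_one.1 d.card_chords.le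
    exact Subtype.ext (this _ x.2 _ y.2)
  have : f = f₁ := by
    funext x
    rw [hsub x (baseChord ⟨1, d, hc, f, hf⟩)]
    refine Eq.trans hd ?_
    exact congrArg f₁ (hsub _ _)
  subst this
  rfl

theorem exists_eq_join {C : DecDiagram D} (hC : 2 ≤ C.size) :
    ∃ (C' C'' : DecDiagram D) (k : Fin (2 * C''.size - 1)), C = C'.join C'' k := by
  obtain ⟨N, d, hc, f, hf⟩ := C
  obtain ⟨p, q, rfl, c', c'', k, h', h'', hJ⟩ :=
    ChordDiagram.exists_eq_join (connected_iff_conn.1 hc) hC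
  have hJ : d = c'.join c'' k := hJ
  subst hJ
  refine ⟨⟨p, c', connected_iff_conn.2 h', fun c => f (c'.joinChordEquiv c'' k (Sum.inl c)),
    fun c => hf _⟩, ⟨q, c'', connected_iff_conn.2 h'',
    fun c => f (c'.joinChordEquiv c'' k (Sum.inr c)), fun c => hf _⟩, k, ?_⟩
  unfold join
  congr 1
  funext c
  obtain ⟨x, rfl⟩ := (c'.joinChordEquiv c'' k).surjective c
  rcases x with x | x <;> simp

/-- The last chord in intersection order is terminal. In a composition this makes the last chord of
`C''` the predecessor of the first non-root terminal chord of `C'`. -/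
theorem exists_terminal_label_eq_size (C : DecDiagram D) :
    ∃ c ∈ C.terminal, C.label c = C.size := by
  induction hn : C.size using Nat.strong_induction_on generalizing C with
  | _ n ih =>
    subst hn
    have hpos := C.size_pos
    rcases Nat.lt_or_ge 1 C.size with h2 | h1
    · obtain ⟨C', C'', k, rfl⟩ := exists_eq_join h2
      have hsize : (C'.join C'' k).size = C'.size + C''.size := rfl
      have h' := C'.size_pos
      have h'' := C''.size_pos
      rw [hsize] at ih ⊢
      rcases Nat.lt_or_ge 1 C'.size with h3 | h3
      · obtain ⟨c, hc, hl⟩ := ih C'.size (by omega) C' rfl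
        have hr : c ≠ C'.rootChord := fun h => by
          rw [h, label_rootChord] at hl; omega
        exact ⟨inl k c, mem_terminal_inl.2 ⟨hr, hc⟩, by rw [label_inl hr, hl]⟩
      · obtain ⟨c, hc, hl⟩ := ih C''.size (by omega) C'' rfl
        exact ⟨inr k c, mem_terminal_inr.2 hc, by rw [label_inr, hl]; omega⟩
    · refine ⟨C.baseChord, C.baseChord_mem, ?_⟩
      have h3 := C.label_pos C.baseChord
      have h4 := C.label_le C.baseChord
      omega

/-- The label gap at the old base chord becomes `(b(C') + |C''|) - (|C''| + 1) = b(C') - 1`. -/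
theorem prevTerminal_inl_baseChord {C' C'' : DecDiagram D} {k : Fin (2 * C''.size - 1)}
    (hr : C'.baseChord ≠ C'.rootChord) :
    (C'.join C'' k).prevTerminal (inl k C'.baseChord) = C''.size + 1 := by
  obtain ⟨d, hd, hl⟩ := C''.exists_terminal_label_eq_size
  rw [← hl, ← label_inr (C' := C') (k := k)]
  have hpos := C'.label_pos C'.baseChord
  have hpos1 : C'.label C'.baseChord ≠ 1 := fun h =>
    hr (C'.label_injective (h.trans C'.label_rootChord.symm))
  refine prevTerminal_eq (mem_terminal_inr.2 hd) (by
    rw [label_inl hr, label_inr, hl]; omega) ?_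
  rw [forall_join]
  refine ⟨fun x hx hxlt => ?_, fun x hx hxlt => ?_⟩
  · have hx := mem_terminal_inl.1 hx
    rw [label_inl hx.1, label_inl hr] at hxlt
    have := b_le hx.2
    rw [b] at this
    omega
  · rw [label_inr, label_inr, hl]
    exact Nat.succ_le_succ (C''.label_le x)

/-- The first connected component of a set of chords without its root. -/
def firstComponent {α : Type*} [LinearOrder α] (S : Finset (α × α)) (h : S.Nonempty) :
    Finset (α × α) :=
  if h' : (S.erase (root S h)).Nonempty then component (S.erase (root S h)) (root _ h') else ∅

theorem firstComponent_union {α : Type*} [LinearOrder α] {A B : Finset (α × α)} {r : α × α}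
    (h : RootShare A B r) : firstComponent (A ∪ B) h.conn.1 = A := by
  have he : ((A ∪ B).erase (root (A ∪ B) h.conn.1)).Nonempty := by
    rw [h.root_eq]; exact h.erase_nonempty
  rw [firstComponent, dif_pos he]
  have := h.component_erase
  simp only [h.root_eq]
  exact this

/-- The size of `C''` for `C = C' ∘ₖ₊₁ C''`. -/
def rightSize (C : DecDiagram D) : ℕ :=
  (firstComponent C.diagram.chords C.chords_nonempty).card

/-- The number `k + 1` for `C = C' ∘ₖ₊₁ C''`. -/
def rightIndex (C : DecDiagram D) : ℕ :=
  numEndpointsBelow (firstComponent C.diagram.chords C.chords_nonempty) C.rootChord.1.2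

theorem firstComponent_join {C' C'' : DecDiagram D} {k : Fin (2 * C''.size - 1)} :
    firstComponent (C'.join C'' k).diagram.chords (C'.join C'' k).chords_nonempty =
      C''.diagram.chords.map (chordEmb (embRight C' C'' k)) := by
  have h := firstComponent_union (rootShare (C' := C') (C'' := C'') (k := k))
  simp only [← chords_join] at h
  exact h

theorem rootChord_join {C' C'' : DecDiagram D} {k : Fin (2 * C''.size - 1)} :
    (C'.join C'' k).rootChord = inl k C'.rootChord :=
  (C'.join C'' k).label_injective (by rw [label_rootChord, label_inl_rootChord])

theorem rightSize_join {C' C'' : DecDiagram D} {k : Fin (2 * C''.size - 1)} :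
    (C'.join C'' k).rightSize = C''.size := by
  rw [rightSize, firstComponent_join, Finset.card_map, C''.diagram.card_chords]

theorem rightIndex_join {C' C'' : DecDiagram D} {k : Fin (2 * C''.size - 1)} :
    (C'.join C'' k).rightIndex = k + 1 := by
  rw [rightIndex, firstComponent_join, rootChord_join]
  exact ChordDiagram.numEndpointsBelow_joinRight _ C'.chords_nonempty _

/-- The first component and its end points below the root's second end determine the sizes and the
index. Only then do both sides have the same types, so that diagrams and decorations can be
compared. -/
theorem join_injective {C' C'' D' D'' : DecDiagram D} {k : Fin (2 * C''.size - 1)}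
    {l : Fin (2 * D''.size - 1)} (h : C'.join C'' k = D'.join D'' l) :
    C' = D' ∧ C'' = D'' ∧ k.1 = l.1 := by
  have hq : C''.size = D''.size := by
    rw [← rightSize_join (C' := C') (k := k), h, rightSize_join]
  have hp : C'.size = D'.size := by
    have : C'.size + C''.size = D'.size + D''.size := congrArg DecDiagram.size h
    omega
  have hk : k.1 = l.1 := by
    have := congrArg rightIndex h
    rw [rightIndex_join, rightIndex_join] at this
    omega
  obtain ⟨p, c', _, f', _⟩ := C'
  obtain ⟨q, c'', _, f'', _⟩ := C''
  obtain ⟨p₁, d', _, g', _⟩ := D'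
  obtain ⟨q₁, d'', _, g'', _⟩ := D''
  dsimp only at hp hq k l hk
  subst hp hq
  obtain rfl : k = l := Fin.ext hk
  obtain ⟨-, h1, h2⟩ := DecDiagram.mk.inj h
  have h1 : c'.join c'' k = d'.join d'' k := eq_of_heq h1
  obtain ⟨rfl, rfl⟩ := ChordDiagram.join_injective h1
  rw [heq_eq_eq] at h2
  have h3 := (Equiv.surjective _).injective_comp_right h2
  have h4 : f' = g' := congrArg (fun F => F ∘ Sum.inl) h3
  have h5 : f'' = g'' := congrArg (fun F => F ∘ Sum.inr) h3
  subst h4 h5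
  exact ⟨rfl, rfl, rfl⟩

end DecDiagram

/-! ### Weights under composition and their sums over the insertion index. -/

namespace DecDiagram

variable {D : Set ℕ+}

section Nu

/-- The insertion tree. -/
def tree (C : DecDiagram D) : LeafTree (Fin (2 * C.size) × Fin (2 * C.size)) :=
  insertionTree C.diagram.chords C.chords_nonempty

theorem mem_leaves_tree {C : DecDiagram D} {c : Fin (2 * C.size) × Fin (2 * C.size)} :
    c ∈ C.tree.leaves ↔ c ∈ C.diagram.chords :=
  (ChordDiagram.insertionTree_spec C.conn).2.2 c

theorem nodup_leaves_tree (C : DecDiagram D) : C.tree.leaves.Nodup :=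
  (ChordDiagram.insertionTree_spec C.conn).2.1

theorem numVertices_tree (C : DecDiagram D) : C.tree.numVertices = 2 * C.size - 1 :=
  (ChordDiagram.insertionTree_spec C.conn).1

/-- The chord whose leaf lies at the lower end of the path that contains edge `k + 1`. -/
def hit (C : DecDiagram D) (k : Fin (2 * C.size - 1)) : C.Chord :=
  ⟨C.tree.hit k, mem_leaves_tree.1 (C.tree.hit_mem k)⟩

theorem sum_hit_eq (C : DecDiagram D) (c : C.Chord) :
    ∑ k, (if C.hit k = c then 1 else 0) = C.nu c + 1 := by
  have h := LeafTree.sum_hit_eq C.nodup_leaves_tree (mem_leaves_tree.2 c.2)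
  rw [numVertices_tree, Finset.sum_range] at h
  rw [nu]
  refine Eq.trans (Finset.sum_congr rfl fun k _ => ?_) h
  simp only [hit, Subtype.ext_iff]

theorem sum_hit {M : Type*} [CommSemiring M] (C : DecDiagram D) (f : C.Chord → M) :
    ∑ k, f (C.hit k) = ∑ c, ((C.nu c : M) + 1) * f c := by
  have h : ∀ c, ((C.nu c : M) + 1) = ∑ k, (if C.hit k = c then 1 else 0) := fun c => by
    have := congrArg (Nat.cast (R := M)) (C.sum_hit_eq c)
    push_cast at this
    exact this.symm
  simp only [h, Finset.sum_mul, ite_mul, one_mul, zero_mul]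
  rw [Finset.sum_comm]
  simp

theorem card_chord (C : DecDiagram D) : Fintype.card C.Chord = C.size := by
  rw [Fintype.card_coe, C.diagram.card_chords]

/-- Each of the `2|C| - 1` edges hits one chord, so `∑ (ν_c + 1) = 2|C| - 1`. -/
theorem sum_nu {R : Type*} [CommRing R] (C : DecDiagram D) :
    ∑ c, ((C.nu c : R) - 1) = -1 := by
  have h := C.sum_hit (fun _ => (1 : R))
  have hpos := C.size_pos
  simp only [mul_one, Finset.sum_add_distrib, Finset.sum_const, Finset.card_univ, card_chord,
    Fintype.card_fin, nsmul_eq_mul] at h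
  rw [Nat.cast_sub (by omega)] at h
  push_cast at h
  simp only [Finset.sum_sub_distrib, Finset.sum_const, Finset.card_univ, card_chord, nsmul_eq_mul,
    mul_one]
  linear_combination -h

variable {C' C'' : DecDiagram D} {k : Fin (2 * C''.size - 1)}

theorem tree_join : (C'.join C'' k).tree = LeafTree.insertAt
    (C'.tree.map (chordEmb (embLeft C' C'' k))) (k + 1)
    (C''.tree.map (chordEmb (embRight C' C'' k))) :=
  ChordDiagram.insertionTree_join C'.conn C''.conn k _

theorem nodup_leaves_append : ((C'.tree.map (chordEmb (embLeft C' C'' k))).leaves ++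
    (C''.tree.map (chordEmb (embRight C' C'' k))).leaves).Nodup := by
  rw [LeafTree.leaves_map, LeafTree.leaves_map]
  refine List.nodup_append.2 ⟨C'.nodup_leaves_tree.map (chordEmb _).injective,
    C''.nodup_leaves_tree.map (chordEmb _).injective, ?_⟩
  simp only [List.mem_map]
  rintro _ ⟨x, -, rfl⟩ _ ⟨y, -, rfl⟩ h
  exact joinLeft_ne_joinRight _ _ (congrArg Prod.fst h)

theorem lt_numVertices_map :
    k.1 < (C''.tree.map (chordEmb (embRight C' C'' k))).numVertices := by
  rw [LeafTree.numVertices_map, numVertices_tree]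
  exact k.2

theorem nu_inl (c : C'.Chord) : (C'.join C'' k).nu (inl k c) = C'.nu c := by
  have hmem : (inl k c).1 ∈ (C'.tree.map (chordEmb (embLeft C' C'' k))).leaves := by
    rw [LeafTree.leaves_map]
    exact List.mem_map_of_mem (mem_leaves_tree.2 c.2)
  change (C'.join C'' k).tree.branchLeft _ = C'.tree.branchLeft _
  rw [tree_join, LeafTree.branchLeft, LeafTree.branchLeftAux_insertAt_left nodup_leaves_append
    hmem lt_numVertices_map]
  exact LeafTree.branchLeft_map (chordEmb _).injective _ _

theorem nu_inr (c : C''.Chord) :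
    (C'.join C'' k).nu (inr k c) = C''.nu c + if C''.hit k = c then 1 else 0 := by
  have hmem : (inr k c).1 ∈ (C''.tree.map (chordEmb (embRight C' C'' k))).leaves := by
    rw [LeafTree.leaves_map]
    exact List.mem_map_of_mem (mem_leaves_tree.2 c.2)
  change (C'.join C'' k).tree.branchLeft _ = C''.tree.branchLeft _ + _
  rw [tree_join, LeafTree.branchLeft, LeafTree.branchLeftAux_insertAt_right nodup_leaves_append
    hmem lt_numVertices_map, LeafTree.hit_map]
  refine congrArg₂ _ (LeafTree.branchLeft_map (chordEmb _).injective _ _) ?_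
  refine if_congr ?_ rfl rfl
  rw [Subtype.ext_iff]
  exact (chordEmb _).injective.eq_iff

theorem nu_of_size_eq_one {C : DecDiagram D} (h : C.size = 1) (c : C.Chord) : C.nu c = 0 := by
  have h1 := C.sum_hit_eq c
  have h2 : ∑ k, (if C.hit k = c then 1 else 0) ≤ ∑ _k : Fin (2 * C.size - 1), 1 :=
    Finset.sum_le_sum fun k _ => by split_ifs <;> simp
  rw [h1, Finset.sum_const, Finset.card_univ, Fintype.card_fin, h] at h2
  simpa using h2

end Nu

section Weights

variable {R : Type*} [CommRing R] {C' C'' : DecDiagram D} {k : Fin (2 * C''.size - 1)}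

open Classical in
theorem monomialHat_eq_prod (a : ℕ+ → ℕ → R) (C : DecDiagram D) :
    monomialHat a C = ∏ c, if c = C.baseChord then 1 else
      if c ∈ C.terminal then a (C.dec c) (C.label c - C.prevTerminal c) else a (C.dec c) 0 := by
  rw [monomialHat, ← Finset.prod_sdiff (Finset.subset_univ C.terminal), mul_comm]
  congr 1
  · refine Finset.prod_congr (by congr!) fun c hc => ?_
    have hc := (Finset.mem_sdiff.1 hc).2
    rw [if_neg fun h : c = C.baseChord => hc (h ▸ C.baseChord_mem), if_neg hc]
  · rw [← Finset.mul_prod_erase _ _ C.baseChord_mem, if_pos rfl, one_mul]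
    refine Finset.prod_congr (by congr!) fun c hc => ?_
    rw [if_neg (Finset.ne_of_mem_erase hc), if_pos (Finset.mem_of_mem_erase hc)]

/-- All label gaps persist; the new factor comes from the base chord of `C'`, no longer a base
chord. If it is not the root of `C'`, its gap is `b(C') - 1`. If it is, it becomes non-terminal and
contributes `a_{d,0}`, which agrees since `b(C') = 1`. -/
theorem monomialHat_join (a : ℕ+ → ℕ → R) :
    monomialHat a (C'.join C'' k) =
      monomialHat a C' * a (C'.dec C'.baseChord) (C'.b - 1) * monomialHat a C'' := by
  classical
  rw [monomialHat_eq_prod, prod_join, monomialHat_eq_prod, monomialHat_eq_prod]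
  congr 1
  · rw [← Finset.mul_prod_erase _ _ (Finset.mem_univ C'.baseChord),
      ← Finset.mul_prod_erase Finset.univ _ (Finset.mem_univ C'.baseChord), if_pos rfl, one_mul,
      mul_comm]
    congr 1
    · refine Finset.prod_congr rfl fun c hc => ?_
      have hb := Finset.ne_of_mem_erase hc
      rw [if_neg (fun h => inl_ne_inr _ _ (h.trans baseChord_join)), if_neg hb, dec_inl]
      by_cases ht : c ∈ C'.terminal
      · have hr : c ≠ C'.rootChord := by
          rintro rfl
          exact hb (eq_rootChord_of_terminal ht _).symm
        rw [if_pos (mem_terminal_inl.2 ⟨hr, ht⟩), if_pos ht, label_inl hr,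
          prevTerminal_inl hr ht hb, Nat.add_sub_add_right]
      · rw [if_neg fun h => ht (mem_terminal_inl.1 h).2, if_neg ht]
    · rw [if_neg (fun h => inl_ne_inr _ _ (h.trans baseChord_join)), dec_inl, b]
      by_cases hr : C'.baseChord = C'.rootChord
      · rw [if_neg fun h => (mem_terminal_inl.1 h).1 hr, hr, label_rootChord]
      · rw [if_pos (mem_terminal_inl.2 ⟨hr, C'.baseChord_mem⟩), label_inl hr,
          prevTerminal_inl_baseChord hr, add_comm C''.size 1, Nat.add_sub_add_right]
  · refine Finset.prod_congr rfl fun c _ => ?_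
    rw [baseChord_join, dec_inr, label_inr]
    by_cases hb : c = C''.baseChord
    · rw [if_pos hb, if_pos (congrArg _ hb)]
    · rw [if_neg hb, if_neg fun h => hb (inr_injective h)]
      by_cases ht : c ∈ C''.terminal
      · rw [if_pos ht, if_pos (mem_terminal_inr.2 ht), prevTerminal_inr ht hb,
          Nat.add_sub_add_right]
      · rw [if_neg ht, if_neg (mt mem_terminal_inr.1 ht)]

variable [Algebra ℚ R]

/-- The factor of a chord with decoration `d` and branch-left number `ν`. -/
def branchFactor (s : R) (d ν : ℕ) : R := binom ((d : R) * s + (ν : R) - 2) ν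

/-- The falling product for `ν + 1` is that for `ν` with one more factor at the top, `d s + ν - 1`.
The multiplicity `ν + 1` of a hit cancels against the factorial. -/
theorem branchFactor_succ (s : R) (d ν : ℕ) :
    ((ν : R) + 1) * branchFactor s d (ν + 1) =
      ((d : R) * s + ν - 1) * branchFactor s d ν := by
  simp only [branchFactor, binom]
  rw [Finset.prod_range_succ']
  have h1 : ∀ m ∈ Finset.range ν, ((d : R) * s + ((ν + 1 : ℕ) : R) - 2 - ((m + 1 : ℕ) : R)) =
      (d : R) * s + ν - 2 - m := by
    intro m _
    push_cast
    ring
  rw [Finset.prod_congr rfl h1]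
  have h2 : (d : R) * s + ((ν + 1 : ℕ) : R) - 2 - ((0 : ℕ) : R) = (d : R) * s + ν - 1 := by
    push_cast
    ring
  rw [h2]
  have h3 : ((ν + 1)! : ℚ)⁻¹ = (ν ! : ℚ)⁻¹ * ((ν : ℚ) + 1)⁻¹ := by
    rw [Nat.factorial_succ]
    push_cast
    rw [mul_inv, mul_comm]
  have h4 : ((ν : R) + 1) = algebraMap ℚ R ((ν : ℚ) + 1) := by simp
  have h5 : ((ν : ℚ) + 1) ≠ 0 := by positivity
  rw [h3, h4, Algebra.smul_def, Algebra.smul_def, map_mul]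
  have h6 : algebraMap ℚ R ((ν : ℚ) + 1) * algebraMap ℚ R (((ν : ℚ) + 1)⁻¹) = 1 := by
    rw [← map_mul, mul_inv_cancel₀ h5, map_one]
  linear_combination (algebraMap ℚ R (ν ! : ℚ)⁻¹ * (∏ m ∈ Finset.range ν,
    ((d : R) * s + ν - 2 - m)) * ((d : R) * s + ν - 1)) * h6

/-- The product of the factors of the chords in `T`, where `ν` has been increased by one at the
chord `h`. -/
def weightOn (s : R) (C : DecDiagram D) (T : Finset C.Chord) (h : C.Chord) : R :=
  ∏ c ∈ T, branchFactor s (C.dec c) (C.nu c + if h = c then 1 else 0)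

theorem weightOn_of_mem (s : R) {C : DecDiagram D} {T : Finset C.Chord} {h : C.Chord}
    (hT : h ∈ T) : ((C.nu h : R) + 1) * weightOn s C T h =
      (((C.dec h : ℕ) : R) * s + C.nu h - 1) * ∏ c ∈ T, chordWeight s C c := by
  classical
  rw [weightOn, ← Finset.mul_prod_erase _ _ hT, ← Finset.mul_prod_erase _ (chordWeight s C) hT,
    if_pos rfl, ← mul_assoc, ← mul_assoc, branchFactor_succ]
  congr 1
  refine Finset.prod_congr rfl fun c hc => ?_
  rw [if_neg (Finset.ne_of_mem_erase hc).symm, add_zero]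
  rfl

theorem weightOn_of_notMem (s : R) {C : DecDiagram D} {T : Finset C.Chord} {h : C.Chord}
    (hT : h ∉ T) : weightOn s C T h = ∏ c ∈ T, chordWeight s C c := by
  refine Finset.prod_congr rfl fun c hc => ?_
  rw [if_neg fun e : h = c => hT (e ▸ hc), add_zero]
  rfl

theorem chordWeight_inl (s : R) (c : C'.Chord) :
    chordWeight s (C'.join C'' k) (inl k c) = chordWeight s C' c := by
  rw [chordWeight, chordWeight, dec_inl, nu_inl]

theorem chordWeight_inr (s : R) (c : C''.Chord) : chordWeight s (C'.join C'' k) (inr k c) =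
    branchFactor s (C''.dec c) (C''.nu c + if C''.hit k = c then 1 else 0) := by
  rw [chordWeight, branchFactor, dec_inr, nu_inr]

theorem weight_join (s : R) : weight s (C'.join C'' k) =
    weight s C' * weightOn s C'' Finset.univ (C''.hit k) := by
  rw [weight, prod_join]
  simp only [chordWeight_inl, chordWeight_inr]
  rfl

open Classical in
theorem weightHat_eq (s : R) (C : DecDiagram D) :
    weightHat s C = ∏ c, if c = C.baseChord then 1 else chordWeight s C c := by
  rw [← Finset.mul_prod_erase _ _ (Finset.mem_univ C.baseChord), if_pos rfl, one_mul, weightHat]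
  refine Finset.prod_congr (by congr!) fun c hc => ?_
  rw [if_neg (Finset.ne_of_mem_erase hc)]

theorem weightHat_join (s : R) : weightHat s (C'.join C'' k) =
    weight s C' * weightOn s C'' (Finset.univ.erase C''.baseChord) (C''.hit k) := by
  classical
  rw [weightHat_eq, prod_join]
  congr 1
  · refine Finset.prod_congr rfl fun c _ => ?_
    rw [if_neg (fun h => inl_ne_inr _ _ (h.trans baseChord_join)), chordWeight_inl]
  · rw [← Finset.mul_prod_erase _ _ (Finset.mem_univ C''.baseChord), baseChord_join, if_pos rfl,
      one_mul, weightOn]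
    refine Finset.prod_congr (by congr!) fun c hc => ?_
    rw [if_neg fun h => Finset.ne_of_mem_erase hc (inr_injective h), chordWeight_inr]

/-- Grouping the edges by the chord they hit gives `∑ (d_c s + ν_c - 1)`, evaluated by `sum_nu`. -/
theorem sum_weightOn_univ (s : R) (C : DecDiagram D) :
    ∑ k, weightOn s C Finset.univ (C.hit k) = (s * C.norm - 1) * weight s C := by
  rw [C.sum_hit (weightOn s C Finset.univ)]
  simp only [weightOn_of_mem s (Finset.mem_univ _)]
  rw [← Finset.sum_mul, weight]
  congr 1
  have : ∀ c : C.Chord, ((C.dec c : ℕ) : R) * s + C.nu c - 1 =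
      ((C.dec c : ℕ) : R) * s + (C.nu c - 1) := fun c => by ring
  simp only [this]
  rw [Finset.sum_add_distrib, sum_nu, ← Finset.sum_mul, norm]
  push_cast
  ring

/-- Edges hitting the base chord raise its branch-left number to `n` in `n` ways and change no other
factor. The remaining ones give `∑ (d_c s + ν_c - 1)` over `c` other than the base chord, where `∑
(ν_c - 1) = -1 - (n - 1) = -n`. -/
theorem sum_weightOn_erase (s : R) (C : DecDiagram D) (n : ℕ) :
    ∑ k, (if (C.nu C.baseChord + if C.hit k = C.baseChord then 1 else 0) = n then
      weightOn s C (Finset.univ.erase C.baseChord) (C.hit k) else 0) =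
      (n : R) * (if C.nu C.baseChord + 1 = n then weightHat s C else 0) +
      (s * ((C.norm : R) - (C.dec C.baseChord : ℕ)) - n) *
        (if C.nu C.baseChord = n then weightHat s C else 0) := by
  classical
  rw [C.sum_hit fun h => if (C.nu C.baseChord + if h = C.baseChord then 1 else 0) = n then
      weightOn s C (Finset.univ.erase C.baseChord) h else 0,
    ← Finset.add_sum_erase _ _ (Finset.mem_univ C.baseChord)]
  have hhat : weightHat s C = ∏ c ∈ Finset.univ.erase C.baseChord, chordWeight s C c := by
    rw [weightHat]
  congr 1
  · rw [if_pos rfl, weightOn_of_notMem s (Finset.notMem_erase _ _), ← hhat]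
    split_ifs with h
    · rw [← h]
      push_cast
      ring
    · ring
  · have h1 : ∀ c ∈ Finset.univ.erase C.baseChord, ((C.nu c : R) + 1) *
        (if (C.nu C.baseChord + if c = C.baseChord then 1 else 0) = n then
          weightOn s C (Finset.univ.erase C.baseChord) c else 0) =
        (((C.dec c : ℕ) : R) * s + (C.nu c - 1)) *
          (if C.nu C.baseChord = n then weightHat s C else 0) := by
      intro c hc
      rw [if_neg (Finset.ne_of_mem_erase hc), add_zero]
      split_ifs with h
      · rw [weightOn_of_mem s (by convert hc), hhat]
        ring
      · ring
    rw [Finset.sum_congr rfl h1, ← Finset.sum_mul]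
    split_ifs with h
    · congr 1
      have h2 := Finset.add_sum_erase Finset.univ
        (fun c : C.Chord => ((C.dec c : ℕ) : R) * s + (C.nu c - 1)) (Finset.mem_univ C.baseChord)
      rw [Finset.sum_add_distrib (s := Finset.univ), sum_nu, ← Finset.sum_mul] at h2
      rw [norm]
      push_cast
      rw [← h]
      linear_combination h2
    · ring

end Weights

end DecDiagram

/-! ### Generating series and their recursions. -/

namespace DecDiagram

variable {D : Set ℕ+}

theorem mem_ofNorm {C : DecDiagram D} {w : ℕ} : C ∈ ofNorm D w ↔ C.norm = w := by
  simp [ofNorm]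

theorem norm_pos (C : DecDiagram D) : 0 < C.norm :=
  Finset.sum_pos (fun c _ => (C.dec c).pos) ⟨C.baseChord, Finset.mem_univ _⟩

theorem ofNorm_zero : ofNorm D 0 = ∅ := by
  rw [Finset.eq_empty_iff_forall_notMem]
  intro C hC
  exact C.norm_pos.ne' (mem_ofNorm.1 hC)

theorem two_le_size_join {C' C'' : DecDiagram D} {k : Fin (2 * C''.size - 1)} :
    2 ≤ (C'.join C'' k).size := by
  have h1 := C'.size_pos
  have h2 := C''.size_pos
  change 2 ≤ C'.size + C''.size
  omega

/-- The decomposition theorem as a change of summation variables: sums over diagrams become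
convolutions, which are products of series. -/
theorem sum_ofNorm_of_two_le_size {M : Type*} [AddCommMonoid M] (w : ℕ) (F : DecDiagram D → M)
    (hF : ∀ C : DecDiagram D, C.size = 1 → F C = 0) :
    ∑ C ∈ ofNorm D w, F C = ∑ uv ∈ Finset.HasAntidiagonal.antidiagonal w, ∑ C' ∈ ofNorm D uv.1,
      ∑ C'' ∈ ofNorm D uv.2, ∑ k, F (C'.join C'' k) := by
  classical
  have h1 : ∑ C ∈ ofNorm D w, F C = ∑ C ∈ (ofNorm D w).filter fun C => C.size ≠ 1, F C := by
    symm
    refine Finset.sum_filter_of_ne fun C _ h hs => h (hF C hs)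
  simp only [← Finset.sum_product']
  rw [h1, Finset.sum_sigma', Finset.sum_sigma']
  symm
  refine Finset.sum_bij (fun x _ => join x.1.2.1 x.1.2.2 x.2) ?_ ?_ ?_ (fun _ _ => rfl)
  · rintro ⟨⟨uv, C', C''⟩, k⟩ hx
    simp only [Finset.mem_sigma, Finset.HasAntidiagonal.mem_antidiagonal, Finset.mem_product, mem_ofNorm,
      Finset.mem_univ, and_true] at hx
    have : 2 ≤ (C'.join C'' k).size := two_le_size_join
    rw [Finset.mem_filter, mem_ofNorm, norm_join, hx.2.1, hx.2.2]
    exact ⟨hx.1, fun h => by rw [h] at this; omega⟩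
  · rintro ⟨⟨uv, C', C''⟩, k⟩ hx ⟨⟨uv₁, D', D''⟩, l⟩ hy h
    simp only [Finset.mem_sigma, Finset.HasAntidiagonal.mem_antidiagonal, Finset.mem_product, mem_ofNorm,
      Finset.mem_univ, and_true] at hx hy
    obtain ⟨h1, h2, h3⟩ := join_injective h
    dsimp only at h1 h2 k l h3
    subst h1 h2
    obtain rfl : k = l := Fin.ext h3
    obtain rfl : uv = uv₁ := Prod.ext (hx.2.1.symm.trans hy.2.1) (hx.2.2.symm.trans hy.2.2)
    rfl
  · intro C hC
    rw [Finset.mem_filter, mem_ofNorm] at hC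
    have hpos := C.size_pos
    obtain ⟨C', C'', k, rfl⟩ := exists_eq_join (C := C) (by omega)
    refine ⟨⟨⟨(C'.norm, C''.norm), C', C''⟩, k⟩, ?_, rfl⟩
    simp only [Finset.mem_sigma, Finset.HasAntidiagonal.mem_antidiagonal, Finset.mem_product, mem_ofNorm,
      Finset.mem_univ, and_true]
    rw [← norm_join (k := k)]
    exact hC.1

theorem b_of_size_eq_one {C : DecDiagram D} (h : C.size = 1) : C.b = 1 := by
  have h1 := C.label_pos C.baseChord
  have h2 := C.label_le C.baseChord
  rw [b]
  omega

theorem b_pos (C : DecDiagram D) : 0 < C.b := C.label_pos _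

section Series

variable {R : Type*} [CommRing R]

/-- The derivation `s x ∂ₓ`. -/
def eulerOp (s : R) (f : R⟦X⟧) : R⟦X⟧ := PowerSeries.mk fun i => s * i * PowerSeries.coeff i f

theorem coeff_eulerOp (s : R) (f : R⟦X⟧) (i : ℕ) :
    PowerSeries.coeff i (eulerOp s f) = s * i * PowerSeries.coeff i f := by
  rw [eulerOp, PowerSeries.coeff_mk]

variable [Algebra ℚ R]

theorem coeff_gComb (s : R) (a : ℕ+ → ℕ → R) (l w : ℕ) :
    PowerSeries.coeff w (gComb D s a l) = ∑ C ∈ ofNorm D w, if l ≤ C.b then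
      weight s C * monomialHat a C * a (C.dec C.baseChord) (C.b - l) else 0 := by
  rw [gComb, PowerSeries.coeff_mk, Finset.sum_filter]

theorem coeff_gComb_one (s : R) (a : ℕ+ → ℕ → R) (w : ℕ) :
    PowerSeries.coeff w (gComb D s a 1) = ∑ C ∈ ofNorm D w,
      weight s C * monomialHat a C * a (C.dec C.baseChord) (C.b - 1) := by
  rw [coeff_gComb]
  exact Finset.sum_congr rfl fun C _ => if_pos C.b_pos

/-- The renormalization group equation. -/
theorem gComb_succ (s : R) (a : ℕ+ → ℕ → R) {l : ℕ} (hl : 1 ≤ l) :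
    gComb D s a (l + 1) =
      gComb D s a 1 * (eulerOp s (gComb D s a l) - gComb D s a l) := by
  ext w
  -- Single-chord diagrams have `b = 1 < l + 1` and drop out.
  rw [coeff_gComb, sum_ofNorm_of_two_le_size w _ (fun C h => if_neg (by
    rw [b_of_size_eq_one h]; omega)), PowerSeries.coeff_mul]
  refine Finset.sum_congr rfl fun uv _ => ?_
  rw [coeff_gComb_one, map_sub, coeff_eulerOp, coeff_gComb, Finset.sum_mul]
  refine Finset.sum_congr rfl fun C' _ => ?_
  rw [← sub_one_mul, Finset.mul_sum, Finset.mul_sum]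
  refine Finset.sum_congr rfl fun C'' hC'' => ?_
  rw [mem_ofNorm] at hC''
  simp only [b_join, baseChord_join, dec_inr, weight_join, monomialHat_join,
    Nat.add_le_add_iff_right, Nat.add_sub_add_right]
  split_ifs with h
  · have h2 := sum_weightOn_univ s C''
    rw [hC''] at h2
    calc _ = ∑ k, (weight s C' * monomialHat a C' * a (C'.dec C'.baseChord) (C'.b - 1) *
          monomialHat a C'' * a (C''.dec C''.baseChord) (C''.b - l)) *
          weightOn s C'' Finset.univ (C''.hit k) := Finset.sum_congr rfl fun k _ => by ring
      _ = _ := by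
        rw [← Finset.mul_sum, h2]
        ring
  · simp

/-- The generating series of the diagrams `C` with `b(C) = j + 1` whose base chord has decoration
`1` and branch-left number `n`, without the contributions of the base chord. -/
def bridgeSeries (D : Set ℕ+) (s : R) (a : ℕ+ → ℕ → R) (j n : ℕ) : R⟦X⟧ :=
  PowerSeries.mk fun i => ∑ C ∈ ofNorm D (i + 1),
    if C.dec C.baseChord = 1 ∧ C.nu C.baseChord = n ∧ C.b = j + 1 then
      monomialHat a C * weightHat s C else 0

theorem coeff_bridgeSeries (s : R) (a : ℕ+ → ℕ → R) (j n i : ℕ) :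
    PowerSeries.coeff i (bridgeSeries D s a j n) = ∑ C ∈ ofNorm D (i + 1),
      if C.dec C.baseChord = 1 ∧ C.nu C.baseChord = n ∧ C.b = j + 1 then
        monomialHat a C * weightHat s C else 0 := by
  rw [bridgeSeries, PowerSeries.coeff_mk]

/-- As the base chord has decoration `1`, the other decorations of `C''` sum to `v`, the exponent at
which `bridgeSeries` records `C''`; hence `s v` becomes `s x ∂ₓ`. -/
theorem sum_bridge_join (s : R) (a : ℕ+ → ℕ → R) (C' C'' : DecDiagram D) {j n v : ℕ}
    (hv : C''.norm = v + 1) :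
    (∑ k, if (C'.join C'' k).dec (C'.join C'' k).baseChord = 1 ∧
        (C'.join C'' k).nu (C'.join C'' k).baseChord = n ∧ (C'.join C'' k).b = j + 1 + 1 then
      monomialHat a (C'.join C'' k) * weightHat s (C'.join C'' k) else 0) =
    weight s C' * monomialHat a C' * a (C'.dec C'.baseChord) (C'.b - 1) *
      ((n : R) * (if C''.dec C''.baseChord = 1 ∧ C''.nu C''.baseChord + 1 = n ∧ C''.b = j + 1 then
        monomialHat a C'' * weightHat s C'' else 0) +
      (s * v - n) * (if C''.dec C''.baseChord = 1 ∧ C''.nu C''.baseChord = n ∧ C''.b = j + 1 then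
        monomialHat a C'' * weightHat s C'' else 0)) := by
  simp only [baseChord_join, dec_inr, nu_inr, b_join, monomialHat_join, weightHat_join,
    Nat.add_right_cancel_iff]
  by_cases hd : C''.dec C''.baseChord = 1
  · by_cases hb : C''.b = j + 1
    · have h := sum_weightOn_erase s C'' n
      simp only [hd, hv, hb, true_and, and_true] at h ⊢
      calc _ = ∑ k, (weight s C' * monomialHat a C' * a (C'.dec C'.baseChord) (C'.b - 1) *
            monomialHat a C'') *
            (if (C''.nu C''.baseChord + if C''.hit k = C''.baseChord then 1 else 0) = n then
              weightOn s C'' (Finset.univ.erase C''.baseChord) (C''.hit k) else 0) :=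
            Finset.sum_congr rfl fun k _ => by rw [mul_ite, mul_zero]; congr 1; ring
        _ = _ := by
          rw [← Finset.mul_sum, h]
          push_cast
          split_ifs <;> ring
    · simp [hb]
  · simp [hd]

theorem bridgeSeries_succ (s : R) (a : ℕ+ → ℕ → R) (j n : ℕ) :
    bridgeSeries D s a (j + 1) n = gComb D s a 1 *
      ((n : R⟦X⟧) * bridgeSeries D s a j (n - 1) +
        (eulerOp s (bridgeSeries D s a j n) - (n : R⟦X⟧) * bridgeSeries D s a j n)) := by
  ext i
  rw [coeff_bridgeSeries, sum_ofNorm_of_two_le_size (i + 1) _ (fun C h => if_neg (by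
    -- Splitting off `‖C''‖ = 0`, which no diagram has, leaves `‖C''‖ = v + 1` and the index shift
    -- of `bridgeSeries`.
    rw [b_of_size_eq_one h]; omega)), Finset.Nat.sum_antidiagonal_succ', PowerSeries.coeff_mul]
  simp only [ofNorm_zero, Finset.sum_empty, Finset.sum_const_zero, zero_add]
  refine Finset.sum_congr rfl fun uv _ => ?_
  rw [coeff_gComb_one, Finset.sum_mul]
  refine Finset.sum_congr rfl fun C' _ => ?_
  have hcast : ∀ f : R⟦X⟧, PowerSeries.coeff uv.2 ((n : R⟦X⟧) * f) =
      n * PowerSeries.coeff uv.2 f := fun f => by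
    rw [← map_natCast (PowerSeries.C (R := R)), PowerSeries.coeff_C_mul]
  rw [map_add, map_sub, hcast, hcast, coeff_eulerOp, ← sub_mul, coeff_bridgeSeries,
    coeff_bridgeSeries, Finset.mul_sum, Finset.mul_sum, ← Finset.sum_add_distrib, Finset.mul_sum]
  refine Finset.sum_congr rfl fun C'' hC'' => ?_
  rw [sum_bridge_join s a C' C'' (mem_ofNorm.1 hC'')]
  -- The truncated `n - 1` is harmless at `n = 0`, as that term carries the factor `n`.
  rcases n with _ | n
  · simp
  · simp only [Nat.add_sub_cancel, Nat.add_right_cancel_iff]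

theorem two_le_b {C : DecDiagram D} (h : C.size ≠ 1) : 2 ≤ C.b := by
  have hpos := C.size_pos
  obtain ⟨C', C'', k, rfl⟩ := exists_eq_join (C := C) (by omega)
  rw [b_join]
  have := C''.b_pos
  omega

theorem bridgeSeries_zero_of_pos (s : R) (a : ℕ+ → ℕ → R) {n : ℕ} (hn : n ≠ 0) :
    bridgeSeries D s a 0 n = 0 := by
  ext i
  rw [coeff_bridgeSeries, map_zero]
  refine Finset.sum_eq_zero fun C _ => if_neg ?_
  rintro ⟨-, h1, h2⟩
  by_cases h : C.size = 1
  · exact hn (h1.symm.trans (nu_of_size_eq_one h _))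
  · have := two_le_b h
    omega

theorem chord_subsingleton {C : DecDiagram D} (h : C.size = 1) (c d : C.Chord) : c = d := by
  have := C.diagram.card_chords.trans h
  exact Subtype.ext (Finset.card_le_one.1 this.le _ c.2 _ d.2)

theorem norm_of_size_eq_one {C : DecDiagram D} (h : C.size = 1) :
    C.norm = C.dec C.baseChord := by
  rw [norm, Finset.sum_eq_single C.baseChord]
  · exact fun c _ hc => absurd (chord_subsingleton h _ _) hc
  · exact fun h => absurd (Finset.mem_univ _) h

theorem exists_size_eq_one (hD : 1 ∈ D) :
    ∃ C : DecDiagram D, C.size = 1 ∧ C.dec C.baseChord = 1 := by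
  let d : ChordDiagram 1 :=
    ⟨Equiv.swap 0 1, by decide, by decide⟩
  have hd : Conn d.chords := by
    obtain ⟨c, hc⟩ := Finset.card_eq_one.1 d.card_chords
    refine ⟨⟨c, by simp [hc]⟩, fun B hB hB0 => hB.1.antisymm ?_⟩
    obtain ⟨x, hx⟩ := hB0
    have hxc := hB.1 hx
    rw [hc] at hxc ⊢
    rw [Finset.mem_singleton] at hxc
    subst hxc
    exact Finset.singleton_subset_iff.2 hx
  exact ⟨⟨1, d, connected_iff_conn.2 hd, fun _ => 1, fun _ => hD⟩, rfl, rfl⟩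

theorem bridgeSeries_zero_zero (hD : 1 ∈ D) (s : R) (a : ℕ+ → ℕ → R) :
    bridgeSeries D s a 0 0 = 1 := by
  classical
  obtain ⟨C, hC, hd⟩ := exists_size_eq_one hD
  ext i
  rw [coeff_bridgeSeries, PowerSeries.coeff_one]
  have hsize : ∀ C₁ : DecDiagram D, C₁.b = 0 + 1 → C₁.size = 1 := fun C₁ h => by
    by_contra hs
    have := two_le_b hs
    omega
  split_ifs with hi
  · subst hi
    rw [Finset.sum_eq_single C]
    · rw [if_pos ⟨hd, nu_of_size_eq_one hC _, b_of_size_eq_one hC⟩, monomialHat_eq_prod,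
        weightHat_eq, Finset.prod_eq_one, Finset.prod_eq_one, one_mul]
      · exact fun c _ => if_pos (chord_subsingleton hC _ _)
      · exact fun c _ => if_pos (chord_subsingleton hC _ _)
    · intro C₁ _ hne
      refine if_neg fun h => hne ?_
      exact ext_of_size_eq_one (hsize C₁ h.2.2) hC (h.1.trans hd.symm)
    · intro h
      refine absurd (mem_ofNorm.2 ?_) h
      rw [norm_of_size_eq_one hC, hd]
      rfl
  · refine Finset.sum_eq_zero fun C₁ h₁ => if_neg fun h => hi ?_
    rw [mem_ofNorm, norm_of_size_eq_one (hsize C₁ h.2.2), h.1] at h₁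
    exact (Nat.succ_injective h₁).symm

end Series

end DecDiagram

/-! ### The differential operator as multiplication by a generating series. -/

section DiffOp

variable {R : Type*} [CommRing R]

theorem eulerOp_mul (s : R) (f g : R⟦X⟧) : DecDiagram.eulerOp s (f * g) =
    DecDiagram.eulerOp s f * g + f * DecDiagram.eulerOp s g := by
  ext i
  rw [DecDiagram.coeff_eulerOp, map_add, PowerSeries.coeff_mul, PowerSeries.coeff_mul,
    PowerSeries.coeff_mul, Finset.mul_sum, ← Finset.sum_add_distrib]
  refine Finset.sum_congr rfl fun uv huv => ?_
  rw [DecDiagram.coeff_eulerOp, DecDiagram.coeff_eulerOp, ← Finset.HasAntidiagonal.mem_antidiagonal.1 huv]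
  push_cast
  ring

/-- The operator `s x ∂ₓ` as a linear map. -/
def eulerLin (s : R) : R⟦X⟧ →ₗ[R] R⟦X⟧ where
  toFun := DecDiagram.eulerOp s
  map_add' f g := by
    ext i; simp only [map_add, DecDiagram.coeff_eulerOp]; ring
  map_smul' r f := by
    ext i
    simp only [PowerSeries.coeff_smul, DecDiagram.coeff_eulerOp, smul_eq_mul, RingHom.id_apply]
    ring

/-- The operator `s x ∂ₓ` acting on the coefficients of a power series in `t`. -/
def eulerCoeff (s : R) (H : R⟦X⟧⟦X⟧) : R⟦X⟧⟦X⟧ :=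
  PowerSeries.mk fun j => eulerLin s (PowerSeries.coeff j H)

theorem eulerCoeff_mul (s : R) (F G : R⟦X⟧⟦X⟧) :
    eulerCoeff s (F * G) = eulerCoeff s F * G + F * eulerCoeff s G := by
  ext1 j
  simp only [eulerCoeff, PowerSeries.coeff_mk, map_add, PowerSeries.coeff_mul, map_sum]
  rw [← Finset.sum_add_distrib]
  exact Finset.sum_congr rfl fun uv _ => eulerOp_mul s _ _

theorem eulerCoeff_pow (s : R) (G : R⟦X⟧⟦X⟧) (n : ℕ) :
    eulerCoeff s (G ^ n) = n * G ^ (n - 1) * eulerCoeff s G := by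
  induction n with
  | zero =>
    -- A derivation kills `1`, by the product rule for `1 * 1`.
    have h := eulerCoeff_mul s (1 : R⟦X⟧⟦X⟧) 1
    rw [mul_one, mul_one, one_mul, left_eq_add] at h
    rw [pow_zero, h]
    simp
  | succ n ih =>
    rw [pow_succ, eulerCoeff_mul, ih]
    rcases n with _ | n
    · simp
    · simp only [Nat.add_sub_cancel]
      push_cast
      ring

/-- The pairing of polynomials and power series with `⟨ρ ^ j, t ^ j⟩ = j !`. -/
def pairing (H : R⟦X⟧⟦X⟧) : Polynomial R⟦X⟧ →ₗ[R⟦X⟧] R⟦X⟧ :=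
  Polynomial.lsum fun j =>
    LinearMap.mulRight R⟦X⟧ ((j ! : R⟦X⟧) * PowerSeries.coeff j H)

theorem pairing_monomial (H : R⟦X⟧⟦X⟧) (j : ℕ) (c : R⟦X⟧) :
    pairing H (Polynomial.monomial j c) = c * ((j ! : R⟦X⟧) * PowerSeries.coeff j H) := by
  rw [pairing, Polynomial.lsum_apply, Polynomial.sum_monomial_index] <;> simp [mul_assoc]

theorem pairing_one (p : Polynomial R⟦X⟧) : pairing 1 p = p.eval 0 := by
  induction p using Polynomial.induction_on' with
  | add p q hp hq => rw [map_add, hp, hq, Polynomial.eval_add]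
  | monomial j c =>
    rw [pairing_monomial, Polynomial.eval_monomial, PowerSeries.coeff_one]
    rcases j with _ | j <;> simp

variable [Algebra ℚ R]

/-- The exponential generating series of a sequence. -/
def expSeries (g : ℕ → R⟦X⟧) : R⟦X⟧⟦X⟧ :=
  PowerSeries.mk fun l => if l = 0 then 0 else (l ! : ℚ)⁻¹ • g l

/-- A common truncation bound for several polynomials, from which additivity follows. -/
theorem diffOp_eq_sum (g : ℕ → R⟦X⟧) (p : Polynomial R⟦X⟧) {N : ℕ} (hN : p.natDegree ≤ N) :
    diffOp g p = ∑ l ∈ Finset.Icc 1 N,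
      ((l ! : ℚ)⁻¹ • g l) • Polynomial.derivative^[l] p := by
  rw [diffOp]
  refine Finset.sum_subset (Finset.Icc_subset_Icc_right hN) fun l hl hl' => ?_
  rw [Finset.mem_Icc] at hl hl'
  rw [Polynomial.iterate_derivative_eq_zero (by omega), smul_zero]

theorem diffOp_add (g : ℕ → R⟦X⟧) (p q : Polynomial R⟦X⟧) :
    diffOp g (p + q) = diffOp g p + diffOp g q := by
  rw [diffOp_eq_sum g (p + q) (Polynomial.natDegree_add_le p q), diffOp_eq_sum g p
    (le_max_left p.natDegree q.natDegree), diffOp_eq_sum g q (le_max_right _ _),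
    ← Finset.sum_add_distrib]
  simp only [iterate_map_add, smul_add]

theorem iterate_derivative_monomial {S : Type*} [CommSemiring S] (l j : ℕ) (c : S) :
    Polynomial.derivative^[l] (Polynomial.monomial j c) =
      Polynomial.monomial (j - l) (c * (j.descFactorial l : S)) := by
  induction l with
  | zero => simp
  | succ l ih =>
    rw [Function.iterate_succ_apply', ih, Polynomial.derivative_monomial, Nat.descFactorial_succ,
      Nat.sub_sub]
    push_cast
    congr 1
    ring

/-- The operator `∂_ρ^l` is adjoint to multiplication by `t^l`: on `ρ^j` it yields the factor `j! /
(j-l)!`, and the pairing supplies `(j-l)!`. -/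
theorem pairing_diffOp (g : ℕ → R⟦X⟧) (H : R⟦X⟧⟦X⟧) (p : Polynomial R⟦X⟧) :
    pairing H (diffOp g p) = pairing (expSeries g * H) p := by
  induction p using Polynomial.induction_on' with
  | add p q hp hq => rw [diffOp_add, map_add, map_add, hp, hq]
  | monomial j c =>
    rw [diffOp_eq_sum g _ (Polynomial.natDegree_monomial_le c), pairing_monomial, map_sum,
      PowerSeries.coeff_mul, Finset.Nat.sum_antidiagonal_eq_sum_range_succ_mk, Finset.mul_sum,
      Finset.mul_sum]
    have hsub : Finset.Icc 1 j ⊆ Finset.range (j + 1) := fun l hl => by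
      rw [Finset.mem_Icc] at hl
      rw [Finset.mem_range]
      omega
    rw [← Finset.sum_subset hsub]
    · refine Finset.sum_congr rfl fun l hl => ?_
      rw [Finset.mem_Icc] at hl
      rw [iterate_derivative_monomial, map_smul, pairing_monomial, expSeries,
        PowerSeries.coeff_mk, if_neg (by omega), ← Nat.factorial_mul_descFactorial hl.2,
        smul_eq_mul]
      push_cast
      ring
    · intro l hl hl'
      rw [Finset.mem_range] at hl
      rw [Finset.mem_Icc] at hl'
      rw [expSeries, PowerSeries.coeff_mk, if_pos (by omega)]
      ring

theorem pairing_iterate_diffOp (g : ℕ → R⟦X⟧) (n : ℕ) (H : R⟦X⟧⟦X⟧) (p : Polynomial R⟦X⟧) :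
    pairing H ((diffOp g)^[n] p) = pairing (expSeries g ^ n * H) p := by
  induction n generalizing p with
  | zero => simp
  | succ n ih =>
    rw [Function.iterate_succ_apply, ih, pairing_diffOp, pow_succ', mul_assoc]

theorem eval_iterate_diffOp (g : ℕ → R⟦X⟧) (n j : ℕ) :
    Polynomial.eval 0 ((diffOp g)^[n] (Polynomial.X ^ j)) =
      (j ! : R⟦X⟧) * PowerSeries.coeff j (expSeries g ^ n) := by
  rw [← pairing_one, pairing_iterate_diffOp, mul_one, ← Polynomial.monomial_one_right_eq_X_pow,
    pairing_monomial, one_mul]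

theorem coeff_natCast_mul {S : Type*} [CommSemiring S] (j n : ℕ) (F : S⟦X⟧) :
    PowerSeries.coeff j ((n : S⟦X⟧) * F) = n * PowerSeries.coeff j F := by
  rw [← map_natCast (PowerSeries.C (R := S)), PowerSeries.coeff_C_mul]

/-- The recursion in `l` as a differential equation in `t`. The summand `1` accounts for `l = 0`,
where the derivative has coefficient `g 1` but `expSeries g` has none. -/
theorem derivative_expSeries {s : R} {g : ℕ → R⟦X⟧}
    (hg : ∀ l, 1 ≤ l → g (l + 1) = g 1 * (DecDiagram.eulerOp s (g l) - g l)) :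
    PowerSeries.derivative R⟦X⟧ (expSeries g) =
      PowerSeries.C (g 1) * (1 + (eulerCoeff s (expSeries g) - expSeries g)) := by
  ext1 l
  have hfac : (((l + 1)! : ℚ)⁻¹ * ((l : ℚ) + 1)) = (l ! : ℚ)⁻¹ := by
    rw [Nat.factorial_succ]
    push_cast
    field_simp
  have hcast : ((l : R⟦X⟧) + 1) = algebraMap ℚ R⟦X⟧ ((l : ℚ) + 1) := by simp
  rw [PowerSeries.coeff_derivative, expSeries, PowerSeries.coeff_mk, if_neg (by omega), hcast,
    mul_comm, ← Algebra.smul_def, smul_smul, mul_comm, hfac, PowerSeries.coeff_C_mul, map_add,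
    map_sub, eulerCoeff, PowerSeries.coeff_mk, PowerSeries.coeff_mk, PowerSeries.coeff_one]
  rcases l with _ | l
  · simp
  · rw [if_neg (by omega), if_neg (by omega), hg (l + 1) (by omega),
      LinearMap.map_smul_of_tower, ← smul_sub, zero_add, mul_smul_comm]
    rfl

/-- Multiply the differential equation by `n G^(n-1)`; the derivation rule turns `n G^(n-1) · s x ∂ₓ
G` into `s x ∂ₓ (G^n)`. Comparing coefficients of `t^j` gives the recursion of `bridgeSeries_succ`.
-/
theorem factorial_mul_coeff_succ {s : R} {g : ℕ → R⟦X⟧}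
    (hg : ∀ l, 1 ≤ l → g (l + 1) = g 1 * (DecDiagram.eulerOp s (g l) - g l)) (j n : ℕ) :
    ((j + 1)! : R⟦X⟧) * PowerSeries.coeff (j + 1) (expSeries g ^ n) =
      g 1 * ((n : R⟦X⟧) * ((j ! : R⟦X⟧) * PowerSeries.coeff j (expSeries g ^ (n - 1))) +
        (DecDiagram.eulerOp s ((j ! : R⟦X⟧) * PowerSeries.coeff j (expSeries g ^ n)) -
          (n : R⟦X⟧) * ((j ! : R⟦X⟧) * PowerSeries.coeff j (expSeries g ^ n)))) := by
  have h1 : PowerSeries.derivative R⟦X⟧ (expSeries g ^ n) = PowerSeries.C (g 1) *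
      ((n : R⟦X⟧⟦X⟧) * expSeries g ^ (n - 1) +
        (eulerCoeff s (expSeries g ^ n) - (n : R⟦X⟧⟦X⟧) * expSeries g ^ n)) := by
    rw [PowerSeries.derivative_pow, derivative_expSeries hg, eulerCoeff_pow]
    rcases n with _ | n
    · simp
    · rw [Nat.add_sub_cancel, pow_succ]
      ring
  have h2 := congrArg (PowerSeries.coeff j) h1
  rw [PowerSeries.coeff_derivative, PowerSeries.coeff_C_mul, map_add, map_sub, coeff_natCast_mul,
    coeff_natCast_mul, eulerCoeff, PowerSeries.coeff_mk] at h2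
  have h3 : DecDiagram.eulerOp s ((j ! : R⟦X⟧) * PowerSeries.coeff j (expSeries g ^ n)) =
      (j ! : R⟦X⟧) * eulerLin s (PowerSeries.coeff j (expSeries g ^ n)) := by
    rw [← nsmul_eq_mul, ← nsmul_eq_mul]
    exact map_nsmul (eulerLin s) _ _
  rw [h3, Nat.factorial_succ]
  push_cast
  linear_combination (j ! : R⟦X⟧) * h2

/-- The recursion couples `n` with `n - 1`, so the induction on `j` runs over all `n` at once,
including `n = 0`. -/
theorem bridgeSeries_eq {D : Set ℕ+} (hD : 1 ∈ D) (s : R) (a : ℕ+ → ℕ → R) (j n : ℕ) :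
    DecDiagram.bridgeSeries D s a j n =
      (j ! : R⟦X⟧) * PowerSeries.coeff j (expSeries (DecDiagram.gComb D s a) ^ n) := by
  induction j generalizing n with
  | zero =>
    have h0 : PowerSeries.constantCoeff (expSeries (DecDiagram.gComb D s a)) = 0 := by
      rw [← PowerSeries.coeff_zero_eq_constantCoeff_apply, expSeries, PowerSeries.coeff_mk,
        if_pos rfl]
    rw [PowerSeries.coeff_zero_eq_constantCoeff_apply, map_pow, h0]
    rcases n with _ | n
    · rw [DecDiagram.bridgeSeries_zero_zero hD]
      simp
    · rw [DecDiagram.bridgeSeries_zero_of_pos s a (by omega)]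
      simp
  | succ j ih =>
    rw [DecDiagram.bridgeSeries_succ, ih, ih,
      factorial_mul_coeff_succ (fun l hl => DecDiagram.gComb_succ s a hl)]

end DiffOp

end ChordDSE

end

open Classical in
theorem mainTheorem5 {R : Type*} [CommRing R] [Algebra ℚ R]
    (D : Set ℕ+) (hD : 1 ∈ D) (s : R) (a : ℕ+ → ℕ → R) (n : ℕ) (hn : 1 ≤ n) (i j : ℕ) :
    ∑ C ∈ (ChordDSE.DecDiagram.ofNorm D (i + 1)).filter (fun C =>
        C.dec C.baseChord = 1 ∧ C.nu C.baseChord = n ∧ C.b = j + 1),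
      ChordDSE.DecDiagram.monomialHat a C * ChordDSE.DecDiagram.weightHat s C =
    PowerSeries.coeff i (Polynomial.eval 0
      ((ChordDSE.diffOp (ChordDSE.DecDiagram.gComb D s a))^[n] (Polynomial.X ^ j))) := by
  rw [ChordDSE.eval_iterate_diffOp, ← ChordDSE.bridgeSeries_eq hD,
    ChordDSE.DecDiagram.coeff_bridgeSeries, Finset.sum_filter]
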